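/- **Setting.** There is an infinite set of arms $\mathcal A$. The initial mean rewards $\mu_1(a)$, $a\in\mathcal A$, are i.i.d. random variables on $[0,1]$ such that, for constants $\beta>0$ and $0<c\le C_0$, $c\,x^\beta\le \mathbb P(\mu_1(a)>1-x)\le C_0\,x^\beta$ for all $x\in[0,1]$. In round $t=1,2,\dots,T$ the agent pulls an arm $a_t$ and observes $r_t=\mu_t(a_t)+\eta_t$, where, conditionally on the past (the initial means and all noise terms and rotting rates of earlier rounds), the noise $\eta_t$ is $1$-sub-Gaussian, i.e. $\mathbb E[e^{\lambda\eta_t}\mid \text{past}]\le e^{\lambda^2/2}$ for all $\lambda\in\mathbb R$. Immediately after the pull, an adaptive adversary chooses a rotting rate $\rho_t\ge 0$, depending arbitrarily on everything that has happened so far, and the mean rewards become $\mu_{t+1}(a_t)=\mu_t(a_t)-\rho_t$ and $\mu_{t+1}(a)=\mu_t(a)$ for $a\ne a_t$. In the slow rotting case, $\sum_{t=1}^{T-1}\rho_t\le V_T$ almost surely, for a given $V_T\in[0,T]$. The regret is $R(T)=\sum_{t=1}^{T}(1-\mu_t(a_t))$. **Algorithm** (UCB-threshold with adaptive sliding window,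 with threshold parameter $\delta$). For $s\le t$ let $n_{[s,t]}(a)$ be the number of rounds in $[s,t]$ in which $a$ is pulled, $\widehat\mu_{[s,t]}(a)$ the empirical mean of the rewards of these rounds, and $\mathrm{WUCB}(a,s,t,T)=\widehat\mu_{[s,t]}(a)+\sqrt{12\log (T)/n_{[s,t]}(a)}$. In round $1$ the algorithm selects a new arm $a$, pulls it, and sets $t(a)=1$. In each round $t=2,\dots,T$, with $a$ the current arm and $\mathcal T_t(a)=\{s\in\{1,\dots,T\}: t(a)\le s\le t-1,\ s=t-2^{i}\text{ for some integer } i\ge 0\}$: if $\min_{s\in\mathcal T_t(a)}\mathrm{WUCB}(a,s,t-1,T)<1-\delta$, then it withdraws $a$ for good, selects a new arm $a$ (one never selected before), pulls it, and sets $t(a)=t$; otherwise it pulls the current arm $a$ again. The order in which new arms are selected is an arbitrary fixed sequence of distinct arms. **Theorem.** Fix a constant $0<c_1<1$ and let $$\delta_V(\beta)=\begin{cases}c_1\max\{(V_T/T)^{1/(\beta+2)},\,T^{-1/(\beta+1)}\}&\text{if }\beta\ge 1,\\ c_1\max\{(V_T/T)^{1/3},\,T^{-1/2}\}&\text{if }0<\beta<1.\end{cases}$$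 The algorithm with $\delta=\delta_V(\beta)$ satisfies $$\mathbb E[R(T)]=\begin{cases}\tilde O\big(\max\{V_T^{\frac1{\beta+2}}T^{\frac{\beta+1}{\beta+2}},\,T^{\frac{\beta}{\beta+1}}\}\big)&\text{if }\beta\ge 1,\\ \tilde O\big(\max\{V_T^{1/3}T^{2/3},\,\sqrt T\}\big)&\text{if }0<\beta<1.\end{cases}$$ Here $\mathbb E[R(T)]=\tilde O(f)$ means that there are constants $C>0$ and $k\in\mathbb N$, depending only on $\beta$, $c_1$, $c$ and $C_0$, such that $\mathbb E[R(T)]\le C(1+\log T)^k f$ for all $T\ge 1$, all $V_T\in[0,T]$ and all environments as above. -/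

import Mathlib

open MeasureTheory ProbabilityTheory

namespace RottingBandit

/-! ### Deterministic part: the bandit dynamics and the algorithm along one sample path

Rounds are numbered `1, 2, …, T`; index `0` of the sequences below is never used. -/

/-- `n_{[s,t]}(a)`: the number of rounds in `[s,t]` in which arm `a` was pulled. -/
noncomputable def numPulls {A : Type*} (arms : ℕ → A) (s t : ℕ) (a : A) : ℕ := by
  classical exact ((Finset.Icc s t).filter (fun l => arms l = a)).card

/-- The empirical mean of the rewards of arm `a` over the rounds of `[s,t]`. -/
noncomputable def empMean {A : Type*} (arms : ℕ → A) (r : ℕ → ℝ) (s t : ℕ) (a : A) : ℝ := by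
  classical exact (∑ l ∈ Finset.Icc s t, if arms l = a then r l else 0) / (numPulls arms s t a : ℝ)

/-- The window-UCB index `WUCB(a,s,t,T)`. -/
noncomputable def WUCB {A : Type*} (arms : ℕ → A) (r : ℕ → ℝ) (a : A) (s t T : ℕ) : ℝ :=
  empMean arms r s t a + √(12 * Real.log (T : ℝ) / (numPulls arms s t a : ℝ))

/-- The starting times of the windows of doubling length:
`{s ∈ [T] : t₀ ≤ s ≤ t - 1 and s = t - 2^i for some i ≥ 0}`. -/
def windowStarts (T t₀ t : ℕ) : Set ℕ :=
  {s | 1 ≤ s ∧ s ≤ T ∧ t₀ ≤ s ∧ s + 1 ≤ t ∧ ∃ i : ℕ, s + 2 ^ i = t}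

/-- The mean reward `μ_t(a) = μ_1(a) - ∑_{s<t} ρ_s(a)`, where `ρ_s(a) = ρ_s` if arm `a` is pulled
in round `s` and `ρ_s(a) = 0` otherwise. -/
noncomputable def meanReward {A : Type*} (μ₁ : A → ℝ) (ρ : ℕ → ℝ) (arms : ℕ → A) (t : ℕ) (a : A) :
    ℝ := by
  classical exact μ₁ a - ∑ s ∈ Finset.Ico 1 t, if arms s = a then ρ s else 0

/-- The state of the interaction after some number of rounds. -/
structure Trace (A : Type*) where
  /-- the position, in the order of selection, of the current arm -/
  idx : ℕ
  /-- the round `t(a)` in which the current arm was selected -/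
  start : ℕ
  /-- the arms pulled so far (only the entries of past rounds are meaningful) -/
  arms : ℕ → A
  /-- the rewards observed so far (only the entries of past rounds are meaningful) -/
  rewards : ℕ → ℝ

/-- The threshold condition in round `t`: the minimum over the windows of the window-UCB index of
the current arm is below `1 - δ`. -/
def Trace.Withdraw {A : Type*} (h : Trace A) (sel : ℕ → A) (T : ℕ) (δ : ℝ) (t : ℕ) : Prop :=
  ∃ s ∈ windowStarts T h.start t, WUCB h.arms h.rewards (sel h.idx) s (t - 1) T < 1 - δ

/-- Round `t`: pull the `k`-th arm in the order of selection, which was selected in round `t₀`, and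
observe the reward `r_t = μ_t(a_t) + η_t`. -/
noncomputable def Trace.pull {A : Type*} (h : Trace A) (sel : ℕ → A) (μ₁ : A → ℝ) (ρ η : ℕ → ℝ)
    (t k t₀ : ℕ) : Trace A where
  idx := k
  start := t₀
  arms := Function.update h.arms t (sel k)
  rewards := Function.update h.rewards t (meanReward μ₁ ρ h.arms t (sel k) + η t)

/-- UCB-Threshold with adaptive sliding window, run against the initial means `μ₁`, the rotting
rates `ρ` and the noise `η`: the state after `t` rounds. New arms are selected in the order
`sel 0, sel 1, …`. In round `1` there is no window, so that `sel 0` is pulled, with `t(a) = 1`. -/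
noncomputable def run {A : Type*} (sel : ℕ → A) (T : ℕ) (δ : ℝ) (μ₁ : A → ℝ) (ρ η : ℕ → ℝ) :
    ℕ → Trace A
  | 0 => ⟨0, 1, fun _ => sel 0, fun _ => 0⟩
  | t + 1 => by
      classical
      exact
        let h := run sel T δ μ₁ ρ η t
        if h.Withdraw sel T δ (t + 1) then
          h.pull sel μ₁ ρ η (t + 1) (h.idx + 1) (t + 1)
        else
          h.pull sel μ₁ ρ η (t + 1) h.idx h.start

/-- The regret `∑_{t=1}^T (1 - μ_t(a_t))` of the algorithm along one sample path. -/
noncomputable def regret {A : Type*} (sel : ℕ → A) (T : ℕ) (δ : ℝ) (μ₁ : A → ℝ) (ρ η : ℕ → ℝ) : ℝ :=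
  ∑ t ∈ Finset.Icc 1 T,
    (1 - meanReward μ₁ ρ (run sel T δ μ₁ ρ η T).arms t ((run sel T δ μ₁ ρ η T).arms t))

/-- The threshold parameter `δ_V(β)`. -/
noncomputable def deltaV (c₁ β V : ℝ) (T : ℕ) : ℝ :=
  if 1 ≤ β then
    c₁ * max ((V / T) ^ (1 / (β + 2))) (1 / (T : ℝ) ^ (1 / (β + 1)))
  else
    c₁ * max ((V / T) ^ (1 / 3 : ℝ)) (1 / √(T : ℝ))

/-! ### Probabilistic part -/

/-- The slow rotting environment. `ℱ t` is the information available once round `t` is over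
(`ℱ 0`: before the first round). The initial means are i.i.d. on `[0,1]` with
`cL x^β ≤ ℙ(μ₁(a) > 1 - x) ≤ cU x^β` on `[0,1]`; the noise of each round is `1`-sub-Gaussian
conditionally on the past; the adaptive adversary fixes `ρ_t ≥ 0` after the pull of round `t`,
using anything that has happened so far, with `∑_{t=1}^{T-1} ρ_t ≤ V`. -/
structure IsSlowRotting {A Ω : Type*} [mΩ : MeasurableSpace Ω] (P : Measure Ω)
    (ℱ : Filtration ℕ mΩ) (β cL cU : ℝ) (T : ℕ) (V : ℝ)
    (μ₁ : A → Ω → ℝ) (ρ η : ℕ → Ω → ℝ) : Prop where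
  mean_measurable : ∀ a, Measurable[ℱ 0] (μ₁ a)
  mean_indep : iIndepFun μ₁ P
  mean_ident : ∀ a b, IdentDistrib (μ₁ a) (μ₁ b) P P
  mean_mem : ∀ a, ∀ᵐ ω ∂P, μ₁ a ω ∈ Set.Icc (0 : ℝ) 1
  mean_lower : ∀ a, ∀ x ∈ Set.Icc (0 : ℝ) 1, cL * x ^ β ≤ P.real {ω | 1 - x < μ₁ a ω}
  mean_upper : ∀ a, ∀ x ∈ Set.Icc (0 : ℝ) 1, P.real {ω | 1 - x < μ₁ a ω} ≤ cU * x ^ β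
  noise_measurable : ∀ t, 1 ≤ t → Measurable[ℱ t] (η t)
  noise_integrable : ∀ t, 1 ≤ t → ∀ l : ℝ, Integrable (fun ω => Real.exp (l * η t ω)) P
  noise_subGaussian : ∀ t, 1 ≤ t → ∀ l : ℝ,
    P[fun ω => Real.exp (l * η t ω) | ℱ (t - 1)] ≤ᵐ[P] fun _ => Real.exp (l ^ 2 / 2)
  rot_measurable : ∀ t, 1 ≤ t → Measurable[ℱ t] (ρ t)
  rot_nonneg : ∀ t, 1 ≤ t → ∀ᵐ ω ∂P, 0 ≤ ρ t ω
  rot_budget : ∀ᵐ ω ∂P, ∑ t ∈ Finset.Icc 1 (T - 1), ρ t ω ≤ V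

/-- The regret, as a random variable, of the algorithm with threshold parameter `δ_V(β)`. -/
noncomputable def regretV {A Ω : Type*} (sel : ℕ → A) (T : ℕ) (c₁ β V : ℝ)
    (μ₁ : A → Ω → ℝ) (ρ η : ℕ → Ω → ℝ) (ω : Ω) : ℝ :=
  regret sel T (deltaV c₁ β V T) (fun a => μ₁ a ω) (fun t => ρ t ω) (fun t => η t ω)

end RottingBandit

/-! On the event that every window sum of the noise stays within its confidence width, the threshold
test is reliable in both directions. A withdrawn arm has current suboptimality above `δ`
(`IsRun.lt_gap_of_withdraws`). A kept arm passes the test on windows of doubling length, which tile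
its past, so `N` pulls cost at most `N δ + O(√(N log T))` (`IsRun.sum_gap_le`). Since the
suboptimality never falls below its initial value `Δ`, an arm with `Δ ≥ 2δ` cannot survive long. The
square root is therefore absorbed into `N δ + O(log T / max Δ δ)` (`five_mul_sqrt_le`), and the
regret is at most `2 δ T + V + O(log T) ∑ 1 / max Δ δ`, summed over the arms tried.

The number of arms is limited by the budget: withdrawing an arm with `Δ < δ/2` uses up `δ/2` of
rotting, so fewer than `M ≈ 2V/δ + 1` such arms can be withdrawn. A block of `B ≈ log T / δ^β` fresh
arms contains one with high probability, so at most `M B` arms are tried (`IsRun.idx_lt_of_blocks`).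
This bound is deterministic, so expectations are taken term by term although the stopping of the
search depends on the means. With `b = max β 1`, the expectation of `1 / max Δ δ` is `O(δ^(β-b))` up
to a logarithm (`IsSlowRotting.integral_inv_max_le`).

Altogether the regret is of order `T δ + V + (V/δ + 1) δ^(-b)` up to logarithms. Balancing `T δ`
against `V δ^(-b-1)` and `δ^(-b)` gives the two terms of `rate`. The estimates on the good event
hold path by path, so the adaptivity of the adversary matters only for the noise, which is handled
by conditioning. -/

namespace RottingBandit

/-- The suboptimality `1 - μ_t(a_t)` of the arm pulled in round `t`, when the arm pulled in round
`s` is the `κ s`-th one and the initial mean of the `k`-th arm is `m k`. -/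
noncomputable def gap (m : ℕ → ℝ) (ρ : ℕ → ℝ) (κ : ℕ → ℕ) (t : ℕ) : ℝ :=
  1 - m (κ t) + ∑ u ∈ Finset.Ico 1 t, if κ u = κ t then ρ u else 0

/-- The window-UCB index over the rounds of `[s,t]`, all of which pull the same arm. -/
noncomputable def windowIndex (T : ℕ) (m ρ η : ℕ → ℝ) (κ : ℕ → ℕ) (s t : ℕ) : ℝ :=
  (∑ l ∈ Finset.Icc s t, (1 - gap m ρ κ l + η l)) / ((t + 1 - s : ℕ) : ℝ) +
    √(12 * Real.log (T : ℝ) / ((t + 1 - s : ℕ) : ℝ))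

/-- The current arm is withdrawn after round `t`. -/
def Withdraws (T : ℕ) (δ : ℝ) (m ρ η : ℕ → ℝ) (κ τ : ℕ → ℕ) (t : ℕ) : Prop :=
  ∃ s ∈ windowStarts T (τ t) (t + 1), windowIndex T m ρ η κ s t < 1 - δ

/-- The recursion satisfied by the position `κ t` of the arm pulled in round `t` and the round
`τ t` in which it was selected. -/
structure IsRun (T : ℕ) (δ : ℝ) (m ρ η : ℕ → ℝ) (κ τ : ℕ → ℕ) : Prop where
  idx_zero : κ 0 = 0
  start_zero : τ 0 = 1
  of_withdraws : ∀ t, Withdraws T δ m ρ η κ τ t → κ (t + 1) = κ t + 1 ∧ τ (t + 1) = t + 1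
  of_not_withdraws : ∀ t, ¬ Withdraws T δ m ρ η κ τ t → κ (t + 1) = κ t ∧ τ (t + 1) = τ t

/-! ### Reduction of the algorithm to a recursion on arm positions -/

section Run

variable {A : Type*} {sel : ℕ → A} {T : ℕ} {δ : ℝ} {μ₁ : A → ℝ} {ρ η : ℕ → ℝ}

theorem run_arms_succ_self (t : ℕ) :
    (run sel T δ μ₁ ρ η (t + 1)).arms (t + 1) = sel (run sel T δ μ₁ ρ η (t + 1)).idx := by
  simp only [run]
  split_ifs <;> simp [Trace.pull]

theorem run_arms_succ_of_ne {t s : ℕ} (h : s ≠ t + 1) :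
    (run sel T δ μ₁ ρ η (t + 1)).arms s = (run sel T δ μ₁ ρ η t).arms s := by
  simp only [run]
  split_ifs <;> simp [Trace.pull, h]

theorem run_rewards_succ_self (t : ℕ) :
    (run sel T δ μ₁ ρ η (t + 1)).rewards (t + 1) =
      meanReward μ₁ ρ (run sel T δ μ₁ ρ η t).arms (t + 1) (sel (run sel T δ μ₁ ρ η (t + 1)).idx)
        + η (t + 1) := by
  simp only [run]
  split_ifs <;> simp [Trace.pull]

theorem run_rewards_succ_of_ne {t s : ℕ} (h : s ≠ t + 1) :
    (run sel T δ μ₁ ρ η (t + 1)).rewards s = (run sel T δ μ₁ ρ η t).rewards s := by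
  simp only [run]
  split_ifs <;> simp [Trace.pull, h]

theorem run_arms {s t : ℕ} (hs : 1 ≤ s) (hst : s ≤ t) :
    (run sel T δ μ₁ ρ η t).arms s = sel (run sel T δ μ₁ ρ η s).idx := by
  induction t, hst using Nat.le_induction with
  | base =>
    obtain ⟨s, rfl⟩ := Nat.exists_eq_add_of_le' hs
    exact run_arms_succ_self s
  | succ t hst ih => rw [run_arms_succ_of_ne (by omega), ih]

/-- Along a run, the mean reward of the arm pulled in round `s` is `1 - gap`. -/
theorem meanReward_run (hsel : Function.Injective sel) {s t : ℕ} (hst : s ≤ t + 1) :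
    meanReward μ₁ ρ (run sel T δ μ₁ ρ η t).arms s (sel (run sel T δ μ₁ ρ η s).idx) =
      1 - gap (fun k => μ₁ (sel k)) ρ (fun t => (run sel T δ μ₁ ρ η t).idx) s := by
  unfold meanReward gap
  have : ∀ u ∈ Finset.Ico 1 s, (run sel T δ μ₁ ρ η t).arms u = sel (run sel T δ μ₁ ρ η u).idx := by
    intro u hu
    rw [Finset.mem_Ico] at hu
    exact run_arms hu.1 (by omega)
  have h2 : (∑ u ∈ Finset.Ico 1 s, @ite ℝ ((run sel T δ μ₁ ρ η t).arms u =
        sel (run sel T δ μ₁ ρ η s).idx) (Classical.propDecidable _) (ρ u) 0) =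
      ∑ u ∈ Finset.Ico 1 s, if (run sel T δ μ₁ ρ η u).idx = (run sel T δ μ₁ ρ η s).idx
        then ρ u else 0 := by
    refine Finset.sum_congr rfl fun u hu => ?_
    rw [this u hu]
    simp [hsel.eq_iff]
  simp only [h2]
  ring

theorem run_rewards (hsel : Function.Injective sel) {s t : ℕ} (hs : 1 ≤ s) (hst : s ≤ t) :
    (run sel T δ μ₁ ρ η t).rewards s =
      1 - gap (fun k => μ₁ (sel k)) ρ (fun t => (run sel T δ μ₁ ρ η t).idx) s + η s := by
  induction t, hst using Nat.le_induction with
  | base =>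
    obtain ⟨s, rfl⟩ := Nat.exists_eq_add_of_le' hs
    rw [run_rewards_succ_self, meanReward_run hsel le_rfl]
  | succ t hst ih => rw [run_rewards_succ_of_ne (by omega), ih]

theorem regret_eq_sum_gap (hsel : Function.Injective sel) :
    regret sel T δ μ₁ ρ η = ∑ t ∈ Finset.Icc 1 T,
      gap (fun k => μ₁ (sel k)) ρ (fun t => (run sel T δ μ₁ ρ η t).idx) t := by
  unfold regret
  refine Finset.sum_congr rfl fun t ht => ?_
  rw [Finset.mem_Icc] at ht
  rw [run_arms ht.1 ht.2, meanReward_run hsel (by omega)]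
  ring

theorem run_idx_eq_of_start_le {s t : ℕ} (hs : (run sel T δ μ₁ ρ η t).start ≤ s) (hst : s ≤ t) :
    (run sel T δ μ₁ ρ η s).idx = (run sel T δ μ₁ ρ η t).idx := by
  induction t with
  | zero => rw [Nat.le_zero.1 hst]
  | succ t ih =>
    rcases Nat.of_le_succ hst with h | h
    · by_cases hw : (run sel T δ μ₁ ρ η t).Withdraw sel T δ (t + 1)
      · simp only [run, hw, if_true, Trace.pull] at hs
        omega
      · simp only [run, hw, if_false, Trace.pull] at hs ⊢
        exact ih hs h
    · rw [h]

theorem withdraw_iff (hsel : Function.Injective sel) (t : ℕ) :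
    (run sel T δ μ₁ ρ η t).Withdraw sel T δ (t + 1) ↔
      Withdraws T δ (fun k => μ₁ (sel k)) ρ η (fun t => (run sel T δ μ₁ ρ η t).idx)
        (fun t => (run sel T δ μ₁ ρ η t).start) t := by
  unfold Trace.Withdraw Withdraws
  refine exists_congr fun s => and_congr_right fun hs => ?_
  have harm : ∀ l ∈ Finset.Icc s t,
      (run sel T δ μ₁ ρ η t).arms l = sel (run sel T δ μ₁ ρ η t).idx := by
    intro l hl
    rw [Finset.mem_Icc] at hl
    rw [run_arms (hs.1.trans hl.1) hl.2, run_idx_eq_of_start_le (hs.2.2.1.trans hl.1) hl.2]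
  have hnum : numPulls (run sel T δ μ₁ ρ η t).arms s t (sel (run sel T δ μ₁ ρ η t).idx)
      = t + 1 - s := by
    unfold numPulls
    classical
    rw [Finset.filter_true_of_mem harm, Nat.card_Icc]
  have hsum : empMean (run sel T δ μ₁ ρ η t).arms (run sel T δ μ₁ ρ η t).rewards s t
      (sel (run sel T δ μ₁ ρ η t).idx) = (∑ l ∈ Finset.Icc s t, (1 - gap (fun k => μ₁ (sel k)) ρ
        (fun t => (run sel T δ μ₁ ρ η t).idx) l + η l)) / ((t + 1 - s : ℕ) : ℝ) := by
    unfold empMean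
    rw [hnum]
    congr 1
    refine Finset.sum_congr rfl fun l hl => ?_
    rw [if_pos (harm l hl)]
    rw [Finset.mem_Icc] at hl
    exact run_rewards hsel (hs.1.trans hl.1) hl.2
  unfold WUCB windowIndex
  rw [Nat.add_sub_cancel, hsum, hnum]

theorem isRun_run (hsel : Function.Injective sel) :
    IsRun T δ (fun k => μ₁ (sel k)) ρ η (fun t => (run sel T δ μ₁ ρ η t).idx)
      (fun t => (run sel T δ μ₁ ρ η t).start) where
  idx_zero := rfl
  start_zero := rfl
  of_withdraws t h := by
    rw [← withdraw_iff hsel] at h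
    simp [run, h, Trace.pull]
  of_not_withdraws t h := by
    rw [← withdraw_iff hsel] at h
    simp [run, h, Trace.pull]

end Run

/-! ### Structure of a run along one sample path -/

section Path

variable {T : ℕ} {δ : ℝ} {m ρ η : ℕ → ℝ} {κ τ : ℕ → ℕ}

/-- A window would have to start at some `s ≥ 1` and before round `1`. This makes the unused index
`0` harmless in inductions. -/
theorem not_withdraws_zero : ¬ Withdraws T δ m ρ η κ τ 0 := by
  rintro ⟨s, hs, -⟩
  have := hs.1
  have := hs.2.2.2.1
  omega

theorem IsRun.start_pos (h : IsRun T δ m ρ η κ τ) (t : ℕ) : 1 ≤ τ t := by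
  induction t with
  | zero => exact h.start_zero.ge
  | succ t ih =>
    by_cases hw : Withdraws T δ m ρ η κ τ t
    · rw [(h.of_withdraws t hw).2]; omega
    · rwa [(h.of_not_withdraws t hw).2]

theorem IsRun.start_le (h : IsRun T δ m ρ η κ τ) {t : ℕ} (ht : 1 ≤ t) : τ t ≤ t := by
  induction t, ht using Nat.le_induction with
  | base =>
    rw [(h.of_not_withdraws 0 not_withdraws_zero).2, h.start_zero]
  | succ t ht ih =>
    by_cases hw : Withdraws T δ m ρ η κ τ t
    · rw [(h.of_withdraws t hw).2]
    · rw [(h.of_not_withdraws t hw).2]; omega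

theorem IsRun.idx_mono (h : IsRun T δ m ρ η κ τ) : Monotone κ := by
  refine monotone_nat_of_le_succ fun t => ?_
  by_cases hw : Withdraws T δ m ρ η κ τ t
  · rw [(h.of_withdraws t hw).1]; omega
  · rw [(h.of_not_withdraws t hw).1]

theorem IsRun.idx_start_eq (h : IsRun T δ m ρ η κ τ) {s t : ℕ} (hs : τ t ≤ s) (hst : s ≤ t) :
    κ s = κ t ∧ τ s = τ t := by
  induction t with
  | zero => rw [Nat.le_zero.1 hst]; exact ⟨rfl, rfl⟩
  | succ t ih =>
    rcases Nat.of_le_succ hst with hle | heq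
    · by_cases hw : Withdraws T δ m ρ η κ τ t
      · rw [(h.of_withdraws t hw).2] at hs
        omega
      · obtain ⟨h1, h2⟩ := h.of_not_withdraws t hw
        rw [h2] at hs
        rw [h1, h2]
        exact ih hs hle
    · rw [heq]; exact ⟨rfl, rfl⟩

theorem IsRun.start_eq_one_or (h : IsRun T δ m ρ η κ τ) (t : ℕ) :
    τ t = 1 ∨ ∃ s, 1 ≤ s ∧ τ t = s + 1 ∧ κ s + 1 = κ t := by
  induction t with
  | zero => exact Or.inl h.start_zero
  | succ t ih =>
    by_cases hw : Withdraws T δ m ρ η κ τ t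
    · obtain ⟨h1, h2⟩ := h.of_withdraws t hw
      rcases Nat.eq_zero_or_pos t with rfl | ht
      · exact absurd hw not_withdraws_zero
      · exact Or.inr ⟨t, ht, h2, h1.symm⟩
    · obtain ⟨h1, h2⟩ := h.of_not_withdraws t hw
      rwa [h1, h2]

theorem IsRun.not_withdraws_of_start_le (h : IsRun T δ m ρ η κ τ) {t : ℕ} (ht : τ (t + 1) ≤ t) :
    ¬ Withdraws T δ m ρ η κ τ t := by
  intro hw
  rw [(h.of_withdraws t hw).2] at ht
  omega

theorem initial_gap_le_gap (hρ : ∀ u, 1 ≤ u → 0 ≤ ρ u) (t : ℕ) : 1 - m (κ t) ≤ gap m ρ κ t := by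
  refine le_add_of_nonneg_right (Finset.sum_nonneg fun u hu => ?_)
  split_ifs
  · exact hρ u (Finset.mem_Ico.1 hu).1
  · exact le_rfl

theorem gap_nonneg (hρ : ∀ u, 1 ≤ u → 0 ≤ ρ u) (hm : ∀ k, m k ≤ 1) (t : ℕ) :
    0 ≤ gap m ρ κ t :=
  (sub_nonneg.2 (hm _)).trans (initial_gap_le_gap hρ t)

theorem gap_le (hρ : ∀ u, 1 ≤ u → 0 ≤ ρ u) (hm : ∀ k, 0 ≤ m k) {t : ℕ} (ht : t ≤ T) :
    gap m ρ κ t ≤ 1 + ∑ u ∈ Finset.Ico 1 T, ρ u := by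
  refine add_le_add (by linarith [hm (κ t)]) ?_
  calc ∑ u ∈ Finset.Ico 1 t, (if κ u = κ t then ρ u else 0) ≤ ∑ u ∈ Finset.Ico 1 t, ρ u := by
        refine Finset.sum_le_sum fun u hu => ?_
        split_ifs
        · exact le_rfl
        · exact hρ u (Finset.mem_Ico.1 hu).1
    _ ≤ _ := Finset.sum_le_sum_of_subset_of_nonneg (Finset.Ico_subset_Ico_right ht)
        fun u hu _ => hρ u (Finset.mem_Ico.1 hu).1

theorem gap_mono (hρ : ∀ u, 1 ≤ u → 0 ≤ ρ u) {s t : ℕ} (hst : s ≤ t) (hκ : κ s = κ t) :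
    gap m ρ κ s ≤ gap m ρ κ t := by
  unfold gap
  rw [hκ]
  refine add_le_add le_rfl (Finset.sum_le_sum_of_subset_of_nonneg
    (Finset.Ico_subset_Ico_right hst) fun u hu _ => ?_)
  split_ifs
  · exact hρ u (Finset.mem_Ico.1 hu).1
  · exact le_rfl

theorem gap_succ {t : ℕ} (ht : 1 ≤ t) (hκ : κ t = κ (t + 1)) :
    gap m ρ κ (t + 1) = gap m ρ κ t + ρ t := by
  unfold gap
  rw [Finset.sum_Ico_succ_top ht, hκ, if_pos rfl]
  ring

/-- Positions never decrease and jump at `τ t`, so no earlier round pulled this arm and it has not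
rotted yet. -/
theorem IsRun.gap_start (h : IsRun T δ m ρ η κ τ) {t : ℕ} (ht : τ t = t) :
    gap m ρ κ t = 1 - m (κ t) := by
  unfold gap
  rw [Finset.sum_eq_zero, add_zero]
  intro u hu
  rw [Finset.mem_Ico] at hu
  rw [if_neg]
  rcases h.start_eq_one_or t with h1 | ⟨s, hs1, hs2, hs3⟩
  · omega
  · have := h.idx_mono (show u ≤ s by omega)
    omega

/-! ### Reliability of the threshold test and regret of a single arm -/

/-- All partial sums of the noise over windows are within the confidence width. -/
def NoiseBounded (T : ℕ) (η : ℕ → ℝ) : Prop :=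
  ∀ s t, 1 ≤ s → s ≤ t → t ≤ T →
    |∑ l ∈ Finset.Icc s t, η l| ≤ √(12 * Real.log (T : ℝ) * ((t + 1 - s : ℕ) : ℝ))

theorem mul_windowIndex {s t : ℕ} (hst : s ≤ t) :
    ((t + 1 - s : ℕ) : ℝ) * windowIndex T m ρ η κ s t =
      ((t + 1 - s : ℕ) : ℝ) - ∑ l ∈ Finset.Icc s t, gap m ρ κ l + ∑ l ∈ Finset.Icc s t, η l
        + √(12 * Real.log (T : ℝ) * ((t + 1 - s : ℕ) : ℝ)) := by
  have hn : (0 : ℝ) < ((t + 1 - s : ℕ) : ℝ) := by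
    have : 0 < t + 1 - s := by omega
    exact_mod_cast this
  have h2 : ∑ l ∈ Finset.Icc s t, (1 - gap m ρ κ l + η l) = ((t + 1 - s : ℕ) : ℝ) -
      ∑ l ∈ Finset.Icc s t, gap m ρ κ l + ∑ l ∈ Finset.Icc s t, η l := by
    rw [Finset.sum_add_distrib, Finset.sum_sub_distrib, Finset.sum_const, Nat.card_Icc]
    simp
  unfold windowIndex
  rw [h2]
  set n : ℝ := ((t + 1 - s : ℕ) : ℝ)
  have h3 : √(12 * Real.log (T : ℝ) * n) = n * √(12 * Real.log (T : ℝ) / n) := by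
    rw [show 12 * Real.log (T : ℝ) * n = n ^ 2 * (12 * Real.log (T : ℝ) / n) by field_simp,
      Real.sqrt_mul (sq_nonneg n), Real.sqrt_sq hn.le]
  rw [h3]
  field_simp

/-- The bonus dominates the noise, so an index below `1 - δ` forces the average gap over the window
above `δ`. Gaps only grow while an arm is held, so the last one is at least the average. -/
theorem IsRun.lt_gap_of_withdraws (h : IsRun T δ m ρ η κ τ) (hρ : ∀ u, 1 ≤ u → 0 ≤ ρ u)
    (hη : NoiseBounded T η) {t : ℕ} (ht : t ≤ T) (hw : Withdraws T δ m ρ η κ τ t) :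
    δ < gap m ρ κ t := by
  obtain ⟨s, ⟨hs1, -, hs2, hs3, -⟩, hs⟩ := hw
  have hst : s ≤ t := by omega
  have hn : (0 : ℝ) < ((t + 1 - s : ℕ) : ℝ) := by
    have : 0 < t + 1 - s := by omega
    exact_mod_cast this
  have h1 := mul_lt_mul_of_pos_left hs hn
  rw [mul_windowIndex hst] at h1
  have h2 := (abs_le.1 (hη s t hs1 hst ht)).1
  have h3 : ∑ l ∈ Finset.Icc s t, gap m ρ κ l ≤ ((t + 1 - s : ℕ) : ℝ) * gap m ρ κ t := by
    have := Finset.sum_le_card_nsmul (Finset.Icc s t) (gap m ρ κ) (gap m ρ κ t) (by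
      intro l hl
      rw [Finset.mem_Icc] at hl
      exact gap_mono hρ hl.2 (h.idx_start_eq (hs2.trans hl.1) hl.2).1)
    simpa [Nat.card_Icc] using this
  refine lt_of_mul_lt_mul_left (?_ : ((t + 1 - s : ℕ) : ℝ) * δ < _) hn.le
  nlinarith

/-- The bonus and the noise each contribute one confidence width, whence the factor `2`. -/
theorem sum_gap_le_of_not_withdraws (hη : NoiseBounded T η) {s t i : ℕ} (hs : 1 ≤ s)
    (hτ : τ t ≤ s) (hi : s + 2 ^ i = t + 1) (ht : t ≤ T) (hw : ¬ Withdraws T δ m ρ η κ τ t) :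
    ∑ l ∈ Finset.Icc s t, gap m ρ κ l ≤
      2 ^ i * δ + 2 * √(12 * Real.log (T : ℝ) * 2 ^ i) := by
  have hi' : 1 ≤ 2 ^ i := Nat.one_le_two_pow
  have hst : s ≤ t := by omega
  have hn : ((t + 1 - s : ℕ) : ℝ) = 2 ^ i := by
    rw [show t + 1 - s = 2 ^ i by omega]; simp
  have hge : 1 - δ ≤ windowIndex T m ρ η κ s t := by
    by_contra hlt
    exact hw ⟨s, ⟨hs, hst.trans ht, hτ, by omega, i, hi⟩, not_le.1 hlt⟩
  have h1 := mul_windowIndex (T := T) (m := m) (ρ := ρ) (η := η) (κ := κ) hst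
  have h2 := (abs_le.1 (hη s t hs hst ht)).2
  rw [hn] at h1 h2
  have h3 := mul_le_mul_of_nonneg_left hge (by positivity : (0 : ℝ) ≤ 2 ^ i)
  linarith

/-- The inductive step of the dyadic decomposition. A constant `C` in place of `5` works when `4 + 4
C ≤ C²`. -/
theorem two_mul_sqrt_add_five_mul_sqrt_le {a b : ℝ} (hb : 0 ≤ b) (hab : b ≤ a) :
    2 * √a + 5 * √b ≤ 5 * √(a + b) := by
  have ha : 0 ≤ a := hb.trans hab
  have h1 := Real.sqrt_le_sqrt hab
  have h2 := Real.sq_sqrt ha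
  have h3 := Real.sq_sqrt hb
  have h4 := Real.sq_sqrt (add_nonneg ha hb)
  have h5 := Real.sqrt_nonneg a
  have h6 := Real.sqrt_nonneg b
  refine (pow_le_pow_iff_left₀ (by positivity) (by positivity) two_ne_zero).1 ?_
  nlinarith [mul_le_mul_of_nonneg_left h1 h5]

/-- While an arm is kept, its cumulative suboptimality over `N` pulls is at most
`N δ + O(√(N log T))`. -/
theorem IsRun.sum_gap_le (h : IsRun T δ m ρ η κ τ) (hη : NoiseBounded T η) (N : ℕ) :
    ∀ t, τ t + N = t → t ≤ T → ∑ l ∈ Finset.Ico (τ t) t, gap m ρ κ l ≤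
      N * δ + 5 * √(12 * Real.log (T : ℝ) * N) := by
  induction N using Nat.strong_induction_on with
  | _ N ih =>
    intro t ht htT
    rcases Nat.eq_zero_or_pos N with rfl | hN
    · rw [add_zero] at ht
      simp [ht]
    obtain ⟨t, rfl⟩ := Nat.exists_eq_add_of_le' (show 1 ≤ t by have := h.start_pos t; omega)
    have hw := h.not_withdraws_of_start_le (t := t) (by omega)
    have hτ := (h.of_not_withdraws t hw).2
    -- The longest dyadic window fitting into the `N` pulls is peeled off the end. At most `2 ^ i`
    -- pulls remain; the arm was still held at round `s`, so induction covers them.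
    have hi1 : 2 ^ Nat.log 2 N ≤ N := Nat.pow_log_le_self 2 hN.ne'
    have hi2 : N < 2 ^ (Nat.log 2 N + 1) := Nat.lt_pow_succ_log_self one_lt_two N
    set i := Nat.log 2 N
    have hpos := h.start_pos (t + 1)
    have hi0 : 1 ≤ 2 ^ i := Nat.one_le_two_pow
    obtain ⟨s, hs⟩ : ∃ s, s + 2 ^ i = t + 1 := ⟨t + 1 - 2 ^ i, by omega⟩
    have hτs : τ s = τ (t + 1) := (h.idx_start_eq (by omega) (by omega)).2
    have h1 := sum_gap_le_of_not_withdraws hη (by omega) (by omega : τ t ≤ s) hs (by omega) hw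
    have h2 := ih (N - 2 ^ i) (by omega) s (by omega) (by omega)
    rw [hτs] at h2
    rw [← Finset.sum_Ico_consecutive _ (by omega : τ (t + 1) ≤ s) (by omega : s ≤ t + 1)]
    have h3 : Finset.Ico s (t + 1) = Finset.Icc s t := by ext x; simp
    rw [h3]
    have hL : 0 ≤ 12 * Real.log (T : ℝ) := by
      have := Real.log_natCast_nonneg T
      positivity
    have h4 : (N : ℝ) = 2 ^ i + ((N - 2 ^ i : ℕ) : ℝ) := by
      rw [Nat.cast_sub hi1]; push_cast; ring
    have h5 : ((N - 2 ^ i : ℕ) : ℝ) ≤ 2 ^ i := by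
      have : N - 2 ^ i ≤ 2 ^ i := by rw [pow_succ] at hi2; omega
      exact_mod_cast this
    have h6 := two_mul_sqrt_add_five_mul_sqrt_le
      (by positivity : 0 ≤ 12 * Real.log (T : ℝ) * ((N - 2 ^ i : ℕ) : ℝ))
      (mul_le_mul_of_nonneg_left h5 hL)
    rw [← mul_add, ← h4] at h6
    have h7 : (N : ℝ) * δ = 2 ^ i * δ + ((N - 2 ^ i : ℕ) : ℝ) * δ := by rw [← add_mul, ← h4]
    linarith


/-- If `D ≥ 2δ`, the hypothesis gives `D N ≤ 10 √(12 L N)`, which bounds the square root by `120 L /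
D`. Otherwise `max D δ` is comparable to `δ` and the arithmetic-geometric mean inequality suffices.
-/
theorem five_mul_sqrt_le {L N δ D : ℝ} (hL : 0 ≤ L) (hN : 0 ≤ N) (hδ : 0 < δ)
    (h : D * N ≤ N * δ + 5 * √(12 * L * N)) :
    5 * √(12 * L * N) ≤ N * δ + 600 * L / max D δ := by
  have hy : 0 < max D δ := lt_max_of_lt_right hδ
  rcases hN.eq_or_lt with rfl | hN'
  · simp only [mul_zero, Real.sqrt_zero]
    positivity
  have hq := Real.sqrt_nonneg (12 * L * N)
  have hq2 := Real.sq_sqrt (by positivity : 0 ≤ 12 * L * N)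
  set q := √(12 * L * N)
  rcases le_or_gt (2 * δ) D with hD | hD
  · rw [max_eq_left (by linarith)] at hy ⊢
    have h1 : D * q ≤ 120 * L := by
      refine le_of_mul_le_mul_left (?_ : N * (D * q) ≤ _) hN'
      nlinarith [mul_le_mul_of_nonneg_right hD hN]
    have h2 : 5 * q ≤ 600 * L / D := by
      rw [le_div_iff₀ hy]
      linarith
    nlinarith
  · have h1 : 300 * L / δ ≤ 600 * L / max D δ := by
      rw [div_le_div_iff₀ hδ hy]
      have : max D δ ≤ 2 * δ := max_le hD.le (by linarith)
      nlinarith [mul_le_mul_of_nonneg_left this hL]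
    refine le_trans ?_ (add_le_add le_rfl h1)
    refine (pow_le_pow_iff_left₀ (by positivity) (by positivity) two_ne_zero).1 ?_
    have h3 : N * δ * (300 * L / δ) = 300 * L * N := by field_simp
    nlinarith [sq_nonneg (N * δ - 300 * L / δ), mul_nonneg hL hN]

/-- The cumulative suboptimality of the current arm. -/
theorem IsRun.sum_gap_current_le (h : IsRun T δ m ρ η κ τ) (hη : NoiseBounded T η)
    (hρ : ∀ u, 1 ≤ u → 0 ≤ ρ u) (hm : ∀ k, m k ∈ Set.Icc (0 : ℝ) 1) (hδ : 0 < δ) (hδ1 : δ ≤ 1)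
    {t : ℕ} (ht : 1 ≤ t) (htT : t ≤ T) :
    ∑ l ∈ Finset.Ico (τ t) (t + 1), gap m ρ κ l ≤ 2 * δ * ((t + 1 - τ t : ℕ) : ℝ) +
      1000 * (1 + Real.log (T : ℝ)) * (1 / max (1 - m (κ t)) δ) +
        ∑ u ∈ Finset.Ico (τ t) t, ρ u := by
  obtain ⟨N, hN⟩ := Nat.exists_eq_add_of_le (h.start_le ht)
  have hL := Real.log_natCast_nonneg T
  have hτ := h.start_pos t
  have hy : 0 < max (1 - m (κ t)) δ := lt_max_of_lt_right hδ
  have hy1 : max (1 - m (κ t)) δ ≤ 1 := max_le (by linarith [(hm (κ t)).1]) hδ1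
  have h1 := h.sum_gap_le hη N t hN.symm htT
  have h2 : (1 - m (κ t)) * N ≤ ∑ l ∈ Finset.Ico (τ t) t, gap m ρ κ l := by
    have := Finset.card_nsmul_le_sum (Finset.Ico (τ t) t) (gap m ρ κ) (1 - m (κ t)) (by
      intro l hl
      rw [Finset.mem_Ico] at hl
      rw [← (h.idx_start_eq hl.1 hl.2.le).1]
      exact initial_gap_le_gap hρ l)
    rw [Nat.card_Ico, show t - τ t = N by omega, nsmul_eq_mul] at this
    linarith
  have h3 := five_mul_sqrt_le hL N.cast_nonneg hδ (h2.trans h1)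
  rw [Finset.sum_Ico_succ_top (h.start_le ht)]
  have h4 : ((t + 1 - τ t : ℕ) : ℝ) = N + 1 := by
    rw [show t + 1 - τ t = N + 1 by omega]; simp
  -- Round `t` lies outside the `N` pulls already bounded. Either it is the first pull of the arm,
  -- or the window of length one controls the previous gap, to which one rotting rate is added.
  have h5 : gap m ρ κ t ≤ δ + (1 + 12 * Real.log (T : ℝ)) + ∑ u ∈ Finset.Ico (τ t) t, ρ u := by
    rcases Nat.eq_zero_or_pos N with rfl | hN'
    · rw [h.gap_start (by omega), show τ t = t by omega]
      simp only [Finset.Ico_self, Finset.sum_empty]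
      linarith [(hm (κ t)).1]
    · obtain ⟨s, rfl⟩ := Nat.exists_eq_add_of_le' ht
      have hw := h.not_withdraws_of_start_le (t := s) (by omega)
      have h6 := sum_gap_le_of_not_withdraws (i := 0) hη (by omega)
        (by rw [← (h.of_not_withdraws s hw).2]; omega : τ s ≤ s) (by simp) (by omega) hw
      rw [Finset.Icc_self, Finset.sum_singleton, pow_zero, one_mul, mul_one] at h6
      rw [gap_succ (by omega) (h.of_not_withdraws s hw).1.symm,
        Finset.sum_Ico_succ_top (by omega)]
      have h7 : 0 ≤ ∑ u ∈ Finset.Ico (τ (s + 1)) s, ρ u :=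
        Finset.sum_nonneg fun u hu => hρ u (hτ.trans (Finset.mem_Ico.1 hu).1)
      have h8 := Real.sq_sqrt (by positivity : 0 ≤ 12 * Real.log (T : ℝ))
      nlinarith [sq_nonneg (√(12 * Real.log (T : ℝ)) - 1)]
  have h9 : 1 + 12 * Real.log (T : ℝ) ≤
      (1 + 12 * Real.log (T : ℝ)) * (1 / max (1 - m (κ t)) δ) :=
    le_mul_of_one_le_right (by positivity) (by rw [le_div_iff₀ hy]; linarith)
  have h10 : 600 * Real.log (T : ℝ) / max (1 - m (κ t)) δ =
      600 * Real.log (T : ℝ) * (1 / max (1 - m (κ t)) δ) := by ring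
  have h11 : 0 ≤ 1 / max (1 - m (κ t)) δ := by positivity
  rw [h4]
  nlinarith [mul_nonneg hL h11]

/-- Induction from arm to arm: the rounds before `τ t` end with the last pull of the previous arm.
-/
theorem IsRun.sum_gap_total_le (h : IsRun T δ m ρ η κ τ) (hη : NoiseBounded T η)
    (hρ : ∀ u, 1 ≤ u → 0 ≤ ρ u) (hm : ∀ k, m k ∈ Set.Icc (0 : ℝ) 1) (hδ : 0 < δ) (hδ1 : δ ≤ 1)
    (t : ℕ) : t ≤ T →
    ∑ l ∈ Finset.Ico 1 (t + 1), gap m ρ κ l ≤ 2 * δ * t +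
      1000 * (1 + Real.log (T : ℝ)) * ∑ k ∈ Finset.range (κ t + 1), 1 / max (1 - m k) δ +
        ∑ u ∈ Finset.Ico 1 t, ρ u := by
  have hL := Real.log_natCast_nonneg T
  have hnn : ∀ k, 0 ≤ 1 / max (1 - m k) δ := fun k =>
    one_div_nonneg.2 (hδ.le.trans (le_max_right _ _))
  induction t using Nat.strong_induction_on with
  | _ t ih =>
    intro htT
    rcases Nat.eq_zero_or_pos t with rfl | ht
    · have := Finset.sum_nonneg (s := Finset.range (κ 0 + 1)) fun k _ => hnn k
      simp only [zero_add, Finset.Ico_self, Finset.sum_empty, Nat.cast_zero, mul_zero]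
      rw [show Finset.Ico 1 0 = ∅ by simp, Finset.sum_empty]
      positivity
    have h1 := h.sum_gap_current_le hη hρ hm hδ hδ1 ht htT
    have hτ := h.start_le ht
    have hτ1 := h.start_pos t
    have hbase : ∑ l ∈ Finset.Ico 1 (τ t), gap m ρ κ l ≤ 2 * δ * ((τ t - 1 : ℕ) : ℝ) +
        1000 * (1 + Real.log (T : ℝ)) * ∑ k ∈ Finset.range (κ t), 1 / max (1 - m k) δ +
          ∑ u ∈ Finset.Ico 1 (τ t), ρ u := by
      rcases h.start_eq_one_or t with h2 | ⟨s, hs1, hs2, hs3⟩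
      · have := Finset.sum_nonneg (s := Finset.range (κ t)) fun k _ => hnn k
        rw [h2]
        simp only [Finset.Ico_self, Finset.sum_empty, Nat.sub_self, Nat.cast_zero,
          mul_zero]
        positivity
      · have h3 := ih s (by omega) (by omega)
        -- The rate of round `s` hits the arm withdrawn right afterwards; it causes no regret but is
        -- nonnegative, so it may be included.
        rw [hs2, ← hs3, Nat.add_sub_cancel, Finset.sum_Ico_succ_top hs1 ρ]
        linarith [hρ s hs1]
    rw [← Finset.sum_Ico_consecutive _ hτ1 (by omega : τ t ≤ t + 1),
      ← Finset.sum_Ico_consecutive ρ hτ1 hτ, Finset.sum_range_succ, mul_add]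
    have h4 : (t : ℝ) = ((τ t - 1 : ℕ) : ℝ) + ((t + 1 - τ t : ℕ) : ℝ) := by
      rw [← Nat.cast_add]; congr 1; omega
    have h5 : 2 * δ * (t : ℝ) = 2 * δ * ((τ t - 1 : ℕ) : ℝ) + 2 * δ * ((t + 1 - τ t : ℕ) : ℝ) := by
      rw [← mul_add, ← h4]
    linarith

/-! ### The number of arms selected -/

theorem IsRun.exists_withdraws (h : IsRun T δ m ρ η κ τ) {k n : ℕ} (hk : k < κ n) :
    ∃ t < n, κ t = k ∧ Withdraws T δ m ρ η κ τ t := by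
  induction n with
  | zero => rw [h.idx_zero] at hk; omega
  | succ n ih =>
    by_cases hkn : k < κ n
    · obtain ⟨t, ht, h'⟩ := ih hkn
      exact ⟨t, by omega, h'⟩
    · by_cases hw : Withdraws T δ m ρ η κ τ n
      · rw [(h.of_withdraws n hw).1] at hk
        exact ⟨n, by omega, by omega, hw⟩
      · rw [(h.of_not_withdraws n hw).1] at hk
        omega

/-- A withdrawn arm whose initial mean was above `1 - δ/2` has rotted by at least `δ/2`. -/
theorem IsRun.half_le_sum_rot (h : IsRun T δ m ρ η κ τ) (hη : NoiseBounded T η)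
    (hρ : ∀ u, 1 ≤ u → 0 ≤ ρ u) {k : ℕ} (hk : k < κ T) (hgood : 1 - δ / 2 < m k) :
    δ / 2 ≤ ∑ u ∈ Finset.Ico 1 T, if κ u = k then ρ u else 0 := by
  obtain ⟨t, ht, rfl, hw⟩ := h.exists_withdraws hk
  have h1 := h.lt_gap_of_withdraws hρ hη ht.le hw
  unfold gap at h1
  refine le_trans (by linarith) (Finset.sum_le_sum_of_subset_of_nonneg
    (Finset.Ico_subset_Ico_right ht.le) fun u hu _ => ?_)
  split_ifs
  · exact hρ u (Finset.mem_Ico.1 hu).1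
  · exact le_rfl

/-- Each round rots a single arm, so the amounts spent on distinct withdrawn arms add up to at most
the whole budget. -/
theorem IsRun.card_mul_half_le (h : IsRun T δ m ρ η κ τ) (hη : NoiseBounded T η)
    (hρ : ∀ u, 1 ≤ u → 0 ≤ ρ u) (S : Finset ℕ) (hS : ∀ k ∈ S, k < κ T ∧ 1 - δ / 2 < m k) :
    S.card * (δ / 2) ≤ ∑ u ∈ Finset.Ico 1 T, ρ u := by
  calc S.card * (δ / 2) = ∑ k ∈ S, δ / 2 := by simp
    _ ≤ ∑ k ∈ S, ∑ u ∈ Finset.Ico 1 T, if κ u = k then ρ u else 0 :=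
      Finset.sum_le_sum fun k hk => h.half_le_sum_rot hη hρ (hS k hk).1 (hS k hk).2
    _ = ∑ u ∈ Finset.Ico 1 T, ∑ k ∈ S, if κ u = k then ρ u else 0 := Finset.sum_comm
    _ ≤ ∑ u ∈ Finset.Ico 1 T, ρ u := by
      refine Finset.sum_le_sum fun u hu => ?_
      rw [Finset.sum_ite_eq]
      split_ifs
      · exact le_rfl
      · exact hρ u (Finset.mem_Ico.1 hu).1

/-- If each of `M > 2 V / δ` consecutive blocks of `B` arms contains an arm of initial mean above
`1 - δ/2`, then no more than `M * B` arms are selected. -/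
theorem IsRun.idx_lt_of_blocks (h : IsRun T δ m ρ η κ τ) (hη : NoiseBounded T η)
    (hρ : ∀ u, 1 ≤ u → 0 ≤ ρ u) {V : ℝ} (hV : ∑ u ∈ Finset.Ico 1 T, ρ u ≤ V) {M B : ℕ}
    (hM : V < M * (δ / 2))
    (hB : ∀ j < M, ∃ k ∈ Finset.Ico (j * B) ((j + 1) * B), 1 - δ / 2 < m k) :
    κ T < M * B := by
  by_contra hlt
  push Not at hlt
  choose! f hf hgood using hB
  -- Division by `B` recovers the block, so the representatives are distinct. If `M * B ≤ κ T`, all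
  -- of them have been withdrawn, which overspends the budget.
  have hdiv : ∀ j < M, f j / B = j := by
    intro j hj
    have := Finset.mem_Ico.1 (hf j hj)
    exact Nat.div_eq_of_lt_le this.1 this.2
  have hcard : ((Finset.range M).image f).card = M := by
    rw [Finset.card_image_of_injOn, Finset.card_range]
    intro i hi j hj hij
    rw [← hdiv i (by simpa using hi), ← hdiv j (by simpa using hj)]
    simp only [hij]
  have := h.card_mul_half_le hη hρ ((Finset.range M).image f) (by
    intro k hk
    obtain ⟨j, hj, rfl⟩ := Finset.mem_image.1 hk
    rw [Finset.mem_range] at hj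
    have h1 := (Finset.mem_Ico.1 (hf j hj)).2
    have h2 : (j + 1) * B ≤ M * B := Nat.mul_le_mul_right B hj
    exact ⟨by omega, hgood j hj⟩)
  rw [hcard] at this
  linarith

end Path

/-! ### Concentration of the noise and distribution of the initial means -/

section Probability

variable {A Ω : Type*} [mΩ : MeasurableSpace Ω] {P : Measure Ω}
  {ℱ : Filtration ℕ mΩ} {β cL cU : ℝ} {T : ℕ} {V : ℝ} {μ₁ : A → Ω → ℝ} {ρ η : ℕ → Ω → ℝ}

theorem IsSlowRotting.measurable_noise (h : IsSlowRotting P ℱ β cL cU T V μ₁ ρ η) {t : ℕ}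
    (ht : 1 ≤ t) : Measurable (η t) :=
  (h.noise_measurable t ht).mono (ℱ.le t) le_rfl

theorem IsSlowRotting.measurable_rot (h : IsSlowRotting P ℱ β cL cU T V μ₁ ρ η) {t : ℕ}
    (ht : 1 ≤ t) : Measurable (ρ t) :=
  (h.rot_measurable t ht).mono (ℱ.le t) le_rfl

theorem IsSlowRotting.measurable_mean (h : IsSlowRotting P ℱ β cL cU T V μ₁ ρ η) (a : A) :
    Measurable (μ₁ a) :=
  (h.mean_measurable a).mono (ℱ.le 0) le_rfl

theorem IsSlowRotting.measurable_inv_max (h : IsSlowRotting P ℱ β cL cU T V μ₁ ρ η) (a : A)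
    (δ : ℝ) : Measurable (fun ω => 1 / max (1 - μ₁ a ω) δ) :=
  measurable_const.div ((measurable_const.sub (h.measurable_mean a)).max measurable_const)

theorem IsSlowRotting.measurable_sum_noise (h : IsSlowRotting P ℱ β cL cU T V μ₁ ρ η) {s t : ℕ}
    (hs : 1 ≤ s) : Measurable (fun ω => ∑ i ∈ Finset.Ico s t, η i ω) :=
  Finset.measurable_sum _ fun _ hi => h.measurable_noise (hs.trans (Finset.mem_Ico.1 hi).1)

variable [IsProbabilityMeasure P]

theorem IsSlowRotting.integrable_exp_sum (h : IsSlowRotting P ℱ β cL cU T V μ₁ ρ η) {s : ℕ}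
    (hs : 1 ≤ s) (n : ℕ) (l : ℝ) :
    Integrable (fun ω => Real.exp (l * ∑ i ∈ Finset.Ico s (s + n), η i ω)) P := by
  induction n generalizing l with
  | zero => simp
  | succ n ih =>
    -- Domination by `exp x * exp y ≤ exp (2 x) + exp (2 y)`; the doubled exponent is why the
    -- induction generalizes `l`.
    refine Integrable.mono' ((ih (2 * l)).add (h.noise_integrable (s + n) (by omega) (2 * l)))
      ((h.measurable_sum_noise hs).const_mul l).exp.aestronglyMeasurable
      (Filter.Eventually.of_forall fun ω => ?_)
    rw [Real.norm_of_nonneg (Real.exp_nonneg _), ← add_assoc, Finset.sum_Ico_succ_top (by omega),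
      mul_add, Real.exp_add, Pi.add_apply, mul_assoc 2 l, mul_assoc 2 l, two_mul (l * _),
      two_mul (l * _), Real.exp_add, Real.exp_add]
    nlinarith [sq_nonneg (Real.exp (l * ∑ i ∈ Finset.Ico s (s + n), η i ω)
      - Real.exp (l * η (s + n) ω)), Real.exp_pos (l * ∑ i ∈ Finset.Ico s (s + n), η i ω),
      Real.exp_pos (l * η (s + n) ω), mul_pos
        (Real.exp_pos (l * ∑ i ∈ Finset.Ico s (s + n), η i ω)) (Real.exp_pos (l * η (s + n) ω))]

/-- Conditioning on the past of the last round pulls out the earlier factors and leaves one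
conditional sub-Gaussian bound per round. -/
theorem IsSlowRotting.mgf_sum_le (h : IsSlowRotting P ℱ β cL cU T V μ₁ ρ η) {s : ℕ}
    (hs : 1 ≤ s) (n : ℕ) (l : ℝ) :
    mgf (fun ω => ∑ i ∈ Finset.Ico s (s + n), η i ω) P l ≤ Real.exp (l ^ 2 * n / 2) := by
  unfold mgf
  induction n with
  | zero => simp
  | succ n ih =>
    set f : Ω → ℝ := fun ω => Real.exp (l * ∑ i ∈ Finset.Ico s (s + n), η i ω)
    set g : Ω → ℝ := fun ω => Real.exp (l * η (s + n) ω)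
    have hfg : (fun ω => Real.exp (l * ∑ i ∈ Finset.Ico s (s + (n + 1)), η i ω)) = f * g := by
      funext ω
      rw [← add_assoc, Finset.sum_Ico_succ_top (by omega), mul_add, Real.exp_add]
      rfl
    have hint : Integrable (f * g) P := hfg ▸ h.integrable_exp_sum hs (n + 1) l
    have hfint : Integrable f P := h.integrable_exp_sum hs n l
    have hf : StronglyMeasurable[ℱ (s + n - 1)] f := by
      refine Measurable.stronglyMeasurable (Measurable.exp (Measurable.const_mul
        (Finset.measurable_sum _ fun i hi => ?_) l))
      rw [Finset.mem_Ico] at hi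
      exact (h.noise_measurable i (hs.trans hi.1)).mono (ℱ.mono (by omega)) le_rfl
    have h1 := condExp_mul_of_stronglyMeasurable_left hf hint
      (h.noise_integrable (s + n) (by omega) l)
    have h2 := h.noise_subGaussian (s + n) (by omega) l
    rw [hfg, ← integral_condExp (ℱ.le (s + n - 1)) (f := f * g)]
    calc ∫ ω, (P[f * g | ℱ (s + n - 1)]) ω ∂P ≤ ∫ ω, f ω * Real.exp (l ^ 2 / 2) ∂P := by
          refine integral_mono_ae integrable_condExp (hfint.mul_const _) ?_
          filter_upwards [h1, h2] with ω h1 h2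
          rw [h1]
          exact mul_le_mul_of_nonneg_left h2 (Real.exp_nonneg _)
      _ = (∫ ω, f ω ∂P) * Real.exp (l ^ 2 / 2) := integral_mul_const _ _
      _ ≤ Real.exp (l ^ 2 * n / 2) * Real.exp (l ^ 2 / 2) :=
          mul_le_mul_of_nonneg_right ih (Real.exp_nonneg _)
      _ = Real.exp (l ^ 2 * (n + 1 : ℕ) / 2) := by
          rw [← Real.exp_add]; congr 1; push_cast; ring

/-- Chernoff's bound on both tails, at the optimal parameter `x / n` with `x = √(12 L n)`: the
exponent is `-x² / (2n) = -6 L`. -/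
theorem IsSlowRotting.measureReal_abs_sum_gt_le (h : IsSlowRotting P ℱ β cL cU T V μ₁ ρ η) {s : ℕ}
    (hs : 1 ≤ s) {n : ℕ} (hn : 1 ≤ n) {L : ℝ} (hL : 0 ≤ L) :
    P.real {ω | √(12 * L * n) < |∑ i ∈ Finset.Ico s (s + n), η i ω|} ≤ 2 * Real.exp (-6 * L) := by
  have hn0 : (0 : ℝ) < n := by exact_mod_cast hn
  set S : Ω → ℝ := fun ω => ∑ i ∈ Finset.Ico s (s + n), η i ω with hS
  set x := √(12 * L * n)
  have hx0 : 0 ≤ x := Real.sqrt_nonneg _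
  have hx2 : x ^ 2 = 12 * L * n := Real.sq_sqrt (by positivity)
  have key : -(x / n) * x + (x / n) ^ 2 * n / 2 = -6 * L := by
    field_simp
    rw [hx2]; ring
  have h1 : P.real {ω | x ≤ S ω} ≤ Real.exp (-6 * L) := by
    refine (measure_ge_le_exp_mul_mgf x (by positivity : 0 ≤ x / n)
      (h.integrable_exp_sum hs n _)).trans ?_
    refine (mul_le_mul_of_nonneg_left (h.mgf_sum_le hs n _) (Real.exp_nonneg _)).trans ?_
    rw [← Real.exp_add, key]
  have h2 : P.real {ω | S ω ≤ -x} ≤ Real.exp (-6 * L) := by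
    refine (measure_le_le_exp_mul_mgf (-x) (by simp; positivity : -(x / n) ≤ 0)
      (h.integrable_exp_sum hs n _)).trans ?_
    refine (mul_le_mul_of_nonneg_left (h.mgf_sum_le hs n _) (Real.exp_nonneg _)).trans ?_
    rw [← Real.exp_add]
    refine le_of_eq (congrArg _ ?_)
    rw [← key]; ring
  calc _ ≤ P.real ({ω | x ≤ S ω} ∪ {ω | S ω ≤ -x}) := by
        refine measureReal_mono fun ω hω => ?_
        rcases lt_abs.1 (Set.mem_ofPred_eq ▸ hω) with h' | h'
        · exact Or.inl h'.le
        · exact Or.inr (show S ω ≤ -x by simp only [hS]; linarith)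
    _ ≤ _ := (measureReal_union_le _ _).trans (by linarith)

/-- With probability at least `1 - 2 T⁻⁴` the noise is bounded on all windows. -/
theorem IsSlowRotting.measureReal_not_noiseBounded_le
    (h : IsSlowRotting P ℱ β cL cU T V μ₁ ρ η) :
    P.real {ω | ¬ NoiseBounded T (fun t => η t ω)} ≤
      (T : ℝ) ^ 2 * (2 * Real.exp (-6 * Real.log T)) := by
  have hL := Real.log_natCast_nonneg T
  set E : ℕ × ℕ → Set Ω := fun p => {ω | p.1 ≤ p.2 ∧
    √(12 * Real.log (T : ℝ) * ((p.2 + 1 - p.1 : ℕ) : ℝ)) < |∑ l ∈ Finset.Icc p.1 p.2, η l ω|}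
  calc _ ≤ P.real (⋃ p ∈ Finset.Icc 1 T ×ˢ Finset.Icc 1 T, E p) := by
        refine measureReal_mono (fun ω hω => ?_) (measure_ne_top _ _)
        simp only [NoiseBounded, Set.mem_ofPred_eq] at hω
        push Not at hω
        obtain ⟨s, t, hs, hst, ht, hlt⟩ := hω
        simp only [Set.mem_iUnion]
        exact ⟨(s, t), by simp; omega, hst, hlt⟩
    _ ≤ ∑ p ∈ Finset.Icc 1 T ×ˢ Finset.Icc 1 T, P.real (E p) := measureReal_biUnion_finset_le _ _
    _ ≤ ∑ p ∈ Finset.Icc 1 T ×ˢ Finset.Icc 1 T, 2 * Real.exp (-6 * Real.log T) := by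
        refine Finset.sum_le_sum fun p hp => ?_
        obtain ⟨s, t⟩ := p
        simp only [Finset.mem_product, Finset.mem_Icc] at hp
        by_cases hst : s ≤ t
        · have := h.measureReal_abs_sum_gt_le hp.1.1 (show 1 ≤ t + 1 - s by omega) hL
          rw [show s + (t + 1 - s) = t + 1 by omega,
            show Finset.Ico s (t + 1) = Finset.Icc s t by ext; simp] at this
          refine le_trans (measureReal_mono fun ω hω => ?_) this
          exact hω.2
        · have : E (s, t) = ∅ := by
            ext ω
            simp [E, hst]
          rw [this, measureReal_empty]
          positivity
    _ = _ := by
        rw [Finset.sum_const, Finset.card_product, Nat.card_Icc, nsmul_eq_mul]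
        push_cast
        simp
        ring

theorem IsSlowRotting.measureReal_forall_bad_le (h : IsSlowRotting P ℱ β cL cU T V μ₁ ρ η)
    {sel : ℕ → A} (hsel : Function.Injective sel) {x : ℝ} (hx : x ∈ Set.Icc (0 : ℝ) 1)
    (S : Finset ℕ) :
    P.real {ω | ∀ k ∈ S, ¬ 1 - x < μ₁ (sel k) ω} ≤ Real.exp (-(cL * x ^ β * S.card)) := by
  have hset : {ω | ∀ k ∈ S, ¬ 1 - x < μ₁ (sel k) ω} =
      ⋂ k ∈ S, (μ₁ (sel k)) ⁻¹' (Set.Iic (1 - x)) := by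
    ext ω; simp
  have hind : iIndepFun (fun k => μ₁ (sel k)) P := h.mean_indep.precomp hsel
  rw [hset, measureReal_def, hind.measure_inter_preimage_eq_mul S (fun _ _ => measurableSet_Iic),
    ENNReal.toReal_prod]
  calc ∏ k ∈ S, (P ((μ₁ (sel k)) ⁻¹' (Set.Iic (1 - x)))).toReal
      ≤ ∏ k ∈ S, Real.exp (-(cL * x ^ β)) := by
        refine Finset.prod_le_prod (fun _ _ => ENNReal.toReal_nonneg) fun k _ => ?_
        have h1 := h.mean_lower (sel k) x hx
        have h2 : (μ₁ (sel k)) ⁻¹' (Set.Iic (1 - x)) = {ω | 1 - x < μ₁ (sel k) ω}ᶜ := by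
          ext ω; simp
        rw [← measureReal_def, h2, probReal_compl_eq_one_sub
          (measurableSet_lt measurable_const (h.measurable_mean _))]
        have := Real.add_one_le_exp (-(cL * x ^ β))
        linarith
    _ = _ := by
        rw [Finset.prod_const, ← Real.exp_nat_mul]
        congr 1; ring

theorem IsSlowRotting.measureReal_exists_bad_block_le
    (h : IsSlowRotting P ℱ β cL cU T V μ₁ ρ η) {sel : ℕ → A} (hsel : Function.Injective sel)
    {x : ℝ} (hx : x ∈ Set.Icc (0 : ℝ) 1) (M B : ℕ) :
    P.real {ω | ¬ ∀ j < M, ∃ k ∈ Finset.Ico (j * B) ((j + 1) * B), 1 - x < μ₁ (sel k) ω} ≤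
      M * Real.exp (-(cL * x ^ β * B)) := by
  calc _ ≤ P.real (⋃ j ∈ Finset.range M,
        {ω | ∀ k ∈ Finset.Ico (j * B) ((j + 1) * B), ¬ 1 - x < μ₁ (sel k) ω}) := by
        refine measureReal_mono (fun ω hω => ?_) (measure_ne_top _ _)
        simp only [Set.mem_ofPred_eq] at hω
        push Not at hω
        obtain ⟨j, hj, hbad⟩ := hω
        simp only [Set.mem_iUnion]
        exact ⟨j, by simpa using hj, fun k hk => not_lt.2 (hbad k hk)⟩
    _ ≤ ∑ j ∈ Finset.range M,
        P.real {ω | ∀ k ∈ Finset.Ico (j * B) ((j + 1) * B), ¬ 1 - x < μ₁ (sel k) ω} :=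
        measureReal_biUnion_finset_le _ _
    _ ≤ ∑ j ∈ Finset.range M, Real.exp (-(cL * x ^ β * B)) := by
        refine Finset.sum_le_sum fun j _ => ?_
        refine (h.measureReal_forall_bad_le hsel hx _).trans_eq ?_
        rw [Nat.card_Ico, ← Nat.sub_mul, Nat.add_sub_cancel_left, one_mul]
    _ = _ := by simp

/-- A dyadic layer decomposition of `1 / y`, which turns its expectation into a sum of tail
probabilities. -/
theorem min_inv_two_pow_le {y : ℝ} (hy : 0 < y) (J : ℕ) :
    min (1 / y) (2 ^ J) ≤ 1 + ∑ j ∈ Finset.range J, if y < (1 / 2) ^ j then (2 : ℝ) ^ j else 0 := by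
  induction J with
  | zero => simp
  | succ J ih =>
    rw [Finset.sum_range_succ]
    have h2 : (0 : ℝ) < 2 ^ J := by positivity
    have h3 : ((1 : ℝ) / 2) ^ J = 1 / 2 ^ J := by rw [div_pow, one_pow]
    split_ifs with hlt
    · rw [h3, lt_div_iff₀ h2] at hlt
      have h4 : (2 : ℝ) ^ J ≤ 1 / y := by rw [le_div_iff₀ hy]; linarith
      rw [min_eq_right h4] at ih
      refine (min_le_right _ _).trans ?_
      rw [pow_succ]; linarith
    · rw [h3, not_lt, div_le_iff₀ h2] at hlt
      have h4 : 1 / y ≤ (2 : ℝ) ^ J := by rw [div_le_iff₀ hy]; linarith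
      rw [min_eq_left h4] at ih
      rw [add_zero]
      exact (min_le_left _ _).trans ih

theorem IsSlowRotting.integrable_inv_max (h : IsSlowRotting P ℱ β cL cU T V μ₁ ρ η) (a : A)
    {δ : ℝ} (hδ : 0 < δ) : Integrable (fun ω => 1 / max (1 - μ₁ a ω) δ) P := by
  refine Integrable.of_bound (h.measurable_inv_max a δ).aestronglyMeasurable (1 / δ)
    (Filter.Eventually.of_forall fun ω => ?_)
  rw [Real.norm_of_nonneg (one_div_nonneg.2 (hδ.le.trans (le_max_right _ _)))]
  exact one_div_le_one_div_of_le hδ (le_max_right _ _)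

/-- The expectation of `1 / max Δ δ`, which is the regret, up to a factor `log T`, of testing an arm
of suboptimality `Δ` against the threshold `1 - δ`. -/
theorem IsSlowRotting.integral_inv_max_le (h : IsSlowRotting P ℱ β cL cU T V μ₁ ρ η)
    (hcU : 0 < cU) (a : A) {δ b : ℝ} (hδ : 0 < δ) (hδ1 : δ ≤ 1) (hb1 : 1 ≤ b) (hbβ : β ≤ b) :
    ∫ ω, 1 / max (1 - μ₁ a ω) δ ∂P ≤
      1 + cU * (1 + Real.log (1 / δ) / Real.log 2) * δ ^ (β - b) := by
  obtain ⟨n, hn1, hn2⟩ := exists_nat_pow_near (show 1 ≤ 1 / δ by rw [le_div_iff₀ hδ]; linarith)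
    (one_lt_two (α := ℝ))
  have hpt : ∀ ω, 1 / max (1 - μ₁ a ω) δ ≤ 1 + ∑ j ∈ Finset.range (n + 1),
      Set.indicator {ω | 1 - (1 / 2) ^ j < μ₁ a ω} (fun _ => (2 : ℝ) ^ j) ω := by
    intro ω
    have hy : 0 < max (1 - μ₁ a ω) δ := lt_max_of_lt_right hδ
    have h1 := min_inv_two_pow_le hy (n + 1)
    -- The truncation is inactive, because `1 / δ < 2 ^ (n + 1)`.
    rw [min_eq_left ((one_div_le_one_div_of_le hδ (le_max_right _ _)).trans hn2.le)] at h1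
    refine h1.trans (add_le_add le_rfl (Finset.sum_le_sum fun j _ => ?_))
    rw [Set.indicator_apply]
    have hpos : (0 : ℝ) ≤ 2 ^ j := by positivity
    split_ifs with h2 h3 h3
    · exact le_rfl
    · exact absurd (show ω ∈ {ω | 1 - (1 / 2) ^ j < μ₁ a ω} by
        have := (le_max_left (1 - μ₁ a ω) δ).trans_lt h2
        simp only [Set.mem_ofPred_eq]; linarith) h3
    · exact hpos
    · exact le_rfl
  have hmeas : ∀ j : ℕ, MeasurableSet {ω | 1 - (1 / 2 : ℝ) ^ j < μ₁ a ω} := fun j =>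
    measurableSet_lt measurable_const (h.measurable_mean a)
  have hint : ∀ j : ℕ, Integrable
      (Set.indicator {ω | 1 - (1 / 2) ^ j < μ₁ a ω} (fun _ => (2 : ℝ) ^ j)) P := fun j =>
    (integrable_const _).indicator (hmeas j)
  have hterm : ∀ j ∈ Finset.range (n + 1),
      ∫ ω, Set.indicator {ω | 1 - (1 / 2) ^ j < μ₁ a ω} (fun _ => (2 : ℝ) ^ j) ω ∂P ≤
        cU * δ ^ (β - b) := by
    intro j hj
    have hj' : j ≤ n := by simpa [Nat.lt_succ_iff] using hj
    have h2j : (1 : ℝ) ≤ 2 ^ j := one_le_pow₀ one_le_two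
    have h2j0 : (0 : ℝ) < 2 ^ j := by positivity
    rw [integral_indicator_const _ (hmeas j), smul_eq_mul]
    have hup := h.mean_upper a ((1 / 2) ^ j) ⟨by positivity, pow_le_one₀ (by norm_num) (by norm_num)⟩
    refine (mul_le_mul_of_nonneg_right hup (by positivity)).trans ?_
    rw [mul_assoc]
    refine mul_le_mul_of_nonneg_left ?_ hcU.le
    have e1 : ((1 / 2 : ℝ) ^ j) ^ β * 2 ^ j = ((2 : ℝ) ^ j) ^ (1 - β) := by
      rw [one_div, inv_pow, Real.inv_rpow h2j0.le, Real.rpow_sub h2j0, Real.rpow_one]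
      field_simp
    have e2 : δ ^ (β - b) = (1 / δ) ^ (b - β) := by
      rw [one_div, Real.inv_rpow hδ.le, ← Real.rpow_neg hδ.le]; congr 1; ring
    rw [e1, e2]
    -- `1 ≤ b` allows raising the exponent, and `β ≤ b` makes it nonnegative, so that `2 ^ j` may be
    -- replaced by the larger `1 / δ`.
    calc ((2 : ℝ) ^ j) ^ (1 - β) ≤ ((2 : ℝ) ^ j) ^ (b - β) :=
          Real.rpow_le_rpow_of_exponent_le h2j (by linarith)
      _ ≤ (1 / δ) ^ (b - β) := Real.rpow_le_rpow h2j0.le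
          ((pow_le_pow_right₀ one_le_two hj').trans hn1) (by linarith)
  have hn3 : (n : ℝ) ≤ Real.log (1 / δ) / Real.log 2 := by
    rw [le_div_iff₀ (Real.log_pos one_lt_two), ← Real.log_pow]
    exact Real.log_le_log (by positivity) hn1
  calc ∫ ω, 1 / max (1 - μ₁ a ω) δ ∂P
      ≤ ∫ ω, (1 + ∑ j ∈ Finset.range (n + 1),
        Set.indicator {ω | 1 - (1 / 2) ^ j < μ₁ a ω} (fun _ => (2 : ℝ) ^ j) ω) ∂P :=
        integral_mono (h.integrable_inv_max a hδ)
          ((integrable_const _).add (integrable_finsetSum _ fun j _ => hint j)) hpt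
    _ = 1 + ∑ j ∈ Finset.range (n + 1),
        ∫ ω, Set.indicator {ω | 1 - (1 / 2) ^ j < μ₁ a ω} (fun _ => (2 : ℝ) ^ j) ω ∂P := by
        rw [integral_add (integrable_const _) (integrable_finsetSum _ fun j _ => hint j),
          integral_finsetSum _ fun j _ => hint j]
        simp
    _ ≤ 1 + (n + 1) * (cU * δ ^ (β - b)) := by
        refine add_le_add le_rfl ((Finset.sum_le_sum hterm).trans_eq ?_)
        simp
    _ ≤ _ := by
        have : 0 ≤ cU * δ ^ (β - b) := by positivity
        nlinarith

end Probability

/-! ### Measurability of the run and of the regret -/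

section Measurability

variable {Ω : Type*} [MeasurableSpace Ω] {T : ℕ} {δ : ℝ} {m ρ η : ℕ → Ω → ℝ} {κ τ : ℕ → Ω → ℕ}

theorem measurable_gap (hm : ∀ k, Measurable (m k)) (hρ : ∀ t, 1 ≤ t → Measurable (ρ t)) {l : ℕ}
    (hκ : ∀ s ≤ l, Measurable (κ s)) :
    Measurable (fun ω => gap (fun k => m k ω) (fun t => ρ t ω) (fun t => κ t ω) l) := by
  unfold gap
  -- The arm is random, but its position ranges over the countable set `ℕ`.
  have h1 : Measurable (fun ω => m (κ l ω) ω) :=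
    (measurable_from_prod_countable_right (f := fun p : ℕ × Ω => m p.1 p.2) hm).comp
      ((hκ l le_rfl).prodMk measurable_id)
  refine (measurable_const.sub h1).add (Finset.measurable_sum _ fun u hu => ?_)
  rw [Finset.mem_Ico] at hu
  exact Measurable.ite (measurableSet_eq_fun (hκ u hu.2.le) (hκ l le_rfl)) (hρ u hu.1)
    measurable_const

theorem measurableSet_withdraws (hm : ∀ k, Measurable (m k))
    (hρ : ∀ t, 1 ≤ t → Measurable (ρ t)) (hη : ∀ t, 1 ≤ t → Measurable (η t)) {t : ℕ}
    (hκ : ∀ s ≤ t, Measurable (κ s)) (hτ : Measurable (τ t)) :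
    MeasurableSet {ω | Withdraws T δ (fun k => m k ω) (fun t => ρ t ω) (fun t => η t ω)
      (fun t => κ t ω) (fun t => τ t ω) t} := by
  have hset : {ω | Withdraws T δ (fun k => m k ω) (fun t => ρ t ω) (fun t => η t ω)
      (fun t => κ t ω) (fun t => τ t ω) t} = ⋃ s, ⋃ _ : 1 ≤ s,
      (τ t ⁻¹' {n | s ∈ windowStarts T n (t + 1)}) ∩
        {ω | windowIndex T (fun k => m k ω) (fun t => ρ t ω) (fun t => η t ω)
          (fun t => κ t ω) s t < 1 - δ} := by
    ext ω
    simp only [Withdraws, Set.mem_iUnion]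
    constructor
    · rintro ⟨s, hs, hlt⟩
      exact ⟨s, hs.1, hs, hlt⟩
    · rintro ⟨s, -, hs, hlt⟩
      exact ⟨s, hs, hlt⟩
  rw [hset]
  refine MeasurableSet.iUnion fun s => MeasurableSet.iUnion fun hs =>
    (hτ (MeasurableSet.of_discrete)).inter (measurableSet_lt ?_ measurable_const)
  unfold windowIndex
  refine ((Finset.measurable_sum _ fun l hl => ?_).div_const _).add_const _
  rw [Finset.mem_Icc] at hl
  exact (measurable_const.sub (measurable_gap hm hρ fun u hu => hκ u (hu.trans hl.2))).add
    (hη l (hs.trans hl.1))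

theorem measurable_idx_start (hm : ∀ k, Measurable (m k)) (hρ : ∀ t, 1 ≤ t → Measurable (ρ t))
    (hη : ∀ t, 1 ≤ t → Measurable (η t))
    (h : ∀ ω, IsRun T δ (fun k => m k ω) (fun t => ρ t ω) (fun t => η t ω)
      (fun t => κ t ω) (fun t => τ t ω)) (t : ℕ) :
    ∀ s ≤ t, Measurable (κ s) ∧ Measurable (τ s) := by
  induction t with
  | zero =>
    intro s hs
    obtain rfl := Nat.le_zero.1 hs
    rw [show κ 0 = fun _ => 0 from funext fun ω => (h ω).idx_zero,
      show τ 0 = fun _ => 1 from funext fun ω => (h ω).start_zero]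
    exact ⟨measurable_const, measurable_const⟩
  | succ t ih =>
    intro s hs
    rcases Nat.of_le_succ hs with hs | rfl
    · exact ih s hs
    have hW := measurableSet_withdraws (T := T) (δ := δ) hm hρ hη
      (fun s hs => (ih s hs).1) (ih t le_rfl).2
    set p : Ω → Prop := fun ω => Withdraws T δ (fun k => m k ω) (fun t => ρ t ω)
      (fun t => η t ω) (fun t => κ t ω) (fun t => τ t ω) t
    classical
    have hκ : κ (t + 1) = fun ω => if p ω then κ t ω + 1 else κ t ω := by
      funext ω
      split_ifs with hw
      · exact ((h ω).of_withdraws t hw).1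
      · exact ((h ω).of_not_withdraws t hw).1
    have hτ : τ (t + 1) = fun ω => if p ω then t + 1 else τ t ω := by
      funext ω
      split_ifs with hw
      · exact ((h ω).of_withdraws t hw).2
      · exact ((h ω).of_not_withdraws t hw).2
    rw [Nat.succ_eq_add_one, hκ, hτ]
    exact ⟨Measurable.ite hW ((ih t le_rfl).1.add_const 1) (ih t le_rfl).1,
      Measurable.ite hW measurable_const (ih t le_rfl).2⟩

end Measurability

/-! ### The expected regret for a general threshold -/

section Expectation

variable {A Ω : Type*} [mΩ : MeasurableSpace Ω] {P : Measure Ω}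
  {ℱ : Filtration ℕ mΩ} {β cL cU : ℝ} {T : ℕ} {V : ℝ} {μ₁ : A → Ω → ℝ} {ρ η : ℕ → Ω → ℝ}
  {sel : ℕ → A} {δ : ℝ}

theorem IsSlowRotting.measurable_regret (h : IsSlowRotting P ℱ β cL cU T V μ₁ ρ η)
    (hsel : Function.Injective sel) :
    Measurable (fun ω => regret sel T δ (fun a => μ₁ a ω) (fun t => ρ t ω) (fun t => η t ω)) := by
  simp_rw [regret_eq_sum_gap hsel]
  refine Finset.measurable_sum _ fun t _ => ?_
  exact measurable_gap (κ := fun t ω => (run sel T δ (fun a => μ₁ a ω) (fun t => ρ t ω)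
      (fun t => η t ω) t).idx) (fun k => h.measurable_mean (sel k)) (fun t ht => h.measurable_rot ht)
    fun s hs => (measurable_idx_start (κ := fun t ω => (run sel T δ (fun a => μ₁ a ω)
      (fun t => ρ t ω) (fun t => η t ω) t).idx) (τ := fun t ω => (run sel T δ (fun a => μ₁ a ω)
      (fun t => ρ t ω) (fun t => η t ω) t).start) (fun k => h.measurable_mean (sel k))
      (fun t ht => h.measurable_rot ht) (fun t ht => h.measurable_noise ht)
      (fun ω => isRun_run (T := T) (δ := δ) (μ₁ := fun a => μ₁ a ω) hsel) t s hs).1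

/-- Almost surely, the means are in `[0,1]` and the rotting rates are nonnegative and within the
budget. -/
theorem IsSlowRotting.ae_admissible (h : IsSlowRotting P ℱ β cL cU T V μ₁ ρ η) (sel : ℕ → A) :
    ∀ᵐ ω ∂P, (∀ k, μ₁ (sel k) ω ∈ Set.Icc (0 : ℝ) 1) ∧ (∀ u, 1 ≤ u → 0 ≤ ρ u ω) ∧
      ∑ u ∈ Finset.Ico 1 T, ρ u ω ≤ V := by
  have h1 : ∀ᵐ ω ∂P, ∀ k, μ₁ (sel k) ω ∈ Set.Icc (0 : ℝ) 1 :=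
    ae_all_iff.2 fun k => h.mean_mem (sel k)
  have h2 : ∀ᵐ ω ∂P, ∀ u, 1 ≤ u → 0 ≤ ρ u ω := by
    rw [ae_all_iff]
    intro u
    by_cases hu : 1 ≤ u
    · filter_upwards [h.rot_nonneg u hu] with ω hω _ using hω
    · exact Filter.Eventually.of_forall fun ω hu' => absurd hu' hu
  filter_upwards [h1, h2, h.rot_budget] with ω h1 h2 h3
  refine ⟨h1, h2, ?_⟩
  have : Finset.Ico 1 T = Finset.Icc 1 (T - 1) := by
    ext x; simp only [Finset.mem_Ico, Finset.mem_Icc]; omega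
  rwa [this]

/-- Rotting may push means below zero, but by at most `V` in total, so each round costs at most `1 +
V`. This crude bound is used on the failure event. -/
theorem IsSlowRotting.ae_regret_mem (h : IsSlowRotting P ℱ β cL cU T V μ₁ ρ η)
    (hsel : Function.Injective sel) :
    ∀ᵐ ω ∂P, regret sel T δ (fun a => μ₁ a ω) (fun t => ρ t ω) (fun t => η t ω) ∈
      Set.Icc 0 (T * (1 + V)) := by
  filter_upwards [h.ae_admissible sel] with ω ⟨hm, hρ, hV⟩
  rw [regret_eq_sum_gap hsel]
  refine ⟨Finset.sum_nonneg fun t _ => gap_nonneg hρ (fun k => (hm k).2) t, ?_⟩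
  refine (Finset.sum_le_card_nsmul _ _ (1 + V) fun t ht => ?_).trans_eq ?_
  · exact (gap_le hρ (fun k => (hm k).1) (Finset.mem_Icc.1 ht).2).trans (by linarith)
  · simp [mul_add]

variable [IsProbabilityMeasure P]

theorem IsSlowRotting.integrable_regret (h : IsSlowRotting P ℱ β cL cU T V μ₁ ρ η)
    (hsel : Function.Injective sel) :
    Integrable
      (fun ω => regret sel T δ (fun a => μ₁ a ω) (fun t => ρ t ω) (fun t => η t ω)) P := by
  refine Integrable.of_bound (h.measurable_regret hsel).aestronglyMeasurable (T * (1 + V)) ?_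
  filter_upwards [h.ae_regret_mem (δ := δ) hsel] with ω hω
  rw [Real.norm_of_nonneg hω.1]
  exact hω.2

theorem IsSlowRotting.integral_regret_le (h : IsSlowRotting P ℱ β cL cU T V μ₁ ρ η)
    (hsel : Function.Injective sel) (hcU : 0 < cU) (hV : 0 ≤ V) (hδ : 0 < δ) (hδ1 : δ ≤ 1) {b : ℝ}
    (hb1 : 1 ≤ b) (hbβ : β ≤ b) {M B : ℕ} (hM : V < M * (δ / 2)) :
    ∫ ω, regret sel T δ (fun a => μ₁ a ω) (fun t => ρ t ω) (fun t => η t ω) ∂P ≤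
      2 * δ * T + V + 1000 * (1 + Real.log T) *
        (M * B * (1 + cU * (1 + Real.log (1 / δ) / Real.log 2) * δ ^ (β - b))) +
      T * (1 + V) * ((T : ℝ) ^ 2 * (2 * Real.exp (-6 * Real.log T)) +
        M * Real.exp (-(cL * (δ / 2) ^ β * B))) := by
  have hL := Real.log_natCast_nonneg T
  set F₁ : Set Ω := {ω | ¬ NoiseBounded T (fun t => η t ω)}
  set F₂ : Set Ω :=
    {ω | ¬ ∀ j < M, ∃ k ∈ Finset.Ico (j * B) ((j + 1) * B), 1 - δ / 2 < μ₁ (sel k) ω}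
  -- A measurable hull has the same probability and spares a measurability proof for the two failure
  -- events.
  set F := toMeasurable P (F₁ ∪ F₂)
  have hF : P.real F ≤ (T : ℝ) ^ 2 * (2 * Real.exp (-6 * Real.log T)) +
      M * Real.exp (-(cL * (δ / 2) ^ β * B)) := by
    rw [measureReal_def, measure_toMeasurable, ← measureReal_def]
    exact (measureReal_union_le _ _).trans (add_le_add h.measureReal_not_noiseBounded_le
      (h.measureReal_exists_bad_block_le hsel ⟨by linarith, by linarith⟩ M B))
  have hFm : MeasurableSet F := measurableSet_toMeasurable _ _
  have hsum_int : Integrable (fun ω => ∑ k ∈ Finset.range (M * B),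
      1 / max (1 - μ₁ (sel k) ω) δ) P :=
    integrable_finsetSum _ fun k _ => h.integrable_inv_max (sel k) hδ
  have hbound : ∀ᵐ ω ∂P,
      regret sel T δ (fun a => μ₁ a ω) (fun t => ρ t ω) (fun t => η t ω) ≤
        (2 * δ * T + V) + 1000 * (1 + Real.log T) *
          (∑ k ∈ Finset.range (M * B), 1 / max (1 - μ₁ (sel k) ω) δ) +
        F.indicator (fun _ => T * (1 + V)) ω := by
    filter_upwards [h.ae_admissible sel, h.ae_regret_mem (δ := δ) hsel] with ω ⟨hm, hρ, hV'⟩ hreg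
    have hnn : ∀ k, 0 ≤ 1 / max (1 - μ₁ (sel k) ω) δ := fun k =>
      one_div_nonneg.2 (hδ.le.trans (le_max_right _ _))
    by_cases hω : ω ∈ F
    · rw [Set.indicator_of_mem hω]
      have := Finset.sum_nonneg (s := Finset.range (M * B)) fun k _ => hnn k
      have h2 : 0 ≤ (2 * δ * T + V) + 1000 * (1 + Real.log T) *
          (∑ k ∈ Finset.range (M * B), 1 / max (1 - μ₁ (sel k) ω) δ) := by positivity
      linarith [hreg.2]
    · rw [Set.indicator_of_notMem hω, add_zero]
      have hω' : ω ∉ F₁ ∪ F₂ := fun hmem => hω (subset_toMeasurable P _ hmem)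
      have hη : NoiseBounded T (fun t => η t ω) := by
        by_contra hc
        exact hω' (Or.inl hc)
      have hblock : ∀ j < M, ∃ k ∈ Finset.Ico (j * B) ((j + 1) * B),
          1 - δ / 2 < μ₁ (sel k) ω := by
        by_contra hc
        exact hω' (Or.inr hc)
      have hrun := isRun_run (T := T) (δ := δ) (μ₁ := fun a => μ₁ a ω) (ρ := fun t => ρ t ω)
        (η := fun t => η t ω) hsel
      have hidx := hrun.idx_lt_of_blocks hη hρ hV' hM hblock
      have htot := hrun.sum_gap_total_le hη hρ hm hδ hδ1 T le_rfl
      rw [regret_eq_sum_gap hsel,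
        show Finset.Icc 1 T = Finset.Ico 1 (T + 1) by ext; simp]
      refine htot.trans ?_
      -- The random number `κ T + 1` of arms is replaced by the deterministic `M * B`; the summands
      -- are nonnegative.
      have hmono := Finset.sum_le_sum_of_subset_of_nonneg
        (Finset.range_subset_range.2 (Nat.succ_le_of_lt hidx))
        (f := fun k => 1 / max (1 - μ₁ (sel k) ω) δ) fun k _ _ => hnn k
      have h2 := mul_le_mul_of_nonneg_left hmono
        (by positivity : 0 ≤ 1000 * (1 + Real.log (T : ℝ)))
      simp only [Nat.succ_eq_add_one] at h2
      linarith
  have hint1 : Integrable (fun ω => (2 * δ * T + V) + 1000 * (1 + Real.log T) *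
          (∑ k ∈ Finset.range (M * B), 1 / max (1 - μ₁ (sel k) ω) δ)) P :=
    (integrable_const _).add (hsum_int.const_mul _)
  have hint2 : Integrable (F.indicator (fun _ => (T : ℝ) * (1 + V))) P :=
    (integrable_const _).indicator hFm
  refine (integral_mono_ae (h.integrable_regret hsel) (hint1.add hint2) hbound).trans ?_
  simp only [Pi.add_apply]
  rw [integral_add hint1 hint2, integral_add (integrable_const _) (hsum_int.const_mul _),
    integral_const_mul, integral_finsetSum _ fun k _ => h.integrable_inv_max (sel k) hδ,
    integral_indicator_const _ hFm]
  simp only [integral_const, probReal_univ, smul_eq_mul, one_mul]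
  refine add_le_add (add_le_add le_rfl (mul_le_mul_of_nonneg_left ?_ (by positivity))) ?_
  · refine (Finset.sum_le_sum fun k _ =>
      h.integral_inv_max_le hcU (sel k) hδ hδ1 hb1 hbβ).trans_eq ?_
    rw [Finset.sum_const, Finset.card_range, nsmul_eq_mul, Nat.cast_mul]
  · rw [mul_comm]
    exact mul_le_mul_of_nonneg_left hF (by positivity)

end Expectation

/-! ### Choice of the threshold and the resulting rates -/

/-- The optimal order of the threshold: `T * rate b V T` is the order of the regret. -/
noncomputable def rate (b V : ℝ) (T : ℕ) : ℝ :=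
  max ((V / T) ^ (1 / (b + 2))) (1 / (T : ℝ) ^ (1 / (b + 1)))

section Rate

variable {b V : ℝ} {T : ℕ}

theorem rate_pos (hT : 1 ≤ T) : 0 < rate b V T := by
  have : (0 : ℝ) < T := by exact_mod_cast hT
  exact lt_max_of_lt_right (by positivity)

theorem rate_le_one (hb : 0 ≤ b) (hT : 1 ≤ T) (hV : 0 ≤ V) (hVT : V ≤ T) : rate b V T ≤ 1 := by
  have hT1 : (1 : ℝ) ≤ T := by exact_mod_cast hT
  have hT0 : (0 : ℝ) < T := by linarith
  refine max_le (Real.rpow_le_one (by positivity) ((div_le_one hT0).2 hVT) (by positivity)) ?_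
  exact (div_le_one (by positivity)).2 (Real.one_le_rpow hT1 (by positivity))

theorem budget_le_mul_rate_rpow (hb : 0 ≤ b) (hT : 1 ≤ T) (hV : 0 ≤ V) :
    V ≤ T * rate b V T ^ (b + 2) := by
  have hT0 : (0 : ℝ) < T := by exact_mod_cast hT
  have h0 : 0 ≤ V / T := by positivity
  have h := Real.rpow_le_rpow (Real.rpow_nonneg h0 (1 / (b + 2)))
    (le_max_left _ _ : _ ≤ rate b V T) (by linarith : 0 ≤ b + 2)
  rw [← Real.rpow_mul h0, one_div_mul_cancel (by linarith), Real.rpow_one, div_le_iff₀ hT0, mul_comm] at h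
  exact h

theorem one_le_mul_rate_rpow (hb : 0 ≤ b) (hT : 1 ≤ T) : 1 ≤ T * rate b V T ^ (b + 1) := by
  have hT0 : (0 : ℝ) < T := by exact_mod_cast hT
  have h := Real.rpow_le_rpow (by positivity) (le_max_right _ _ : _ ≤ rate b V T)
    (by linarith : 0 ≤ b + 1)
  rw [Real.div_rpow zero_le_one (by positivity), Real.one_rpow, ← Real.rpow_mul hT0.le,
    one_div_mul_cancel (by linarith), Real.rpow_one, div_le_iff₀ hT0, mul_comm] at h
  exact h

theorem mul_rate (hb : 0 ≤ b) (hT : 1 ≤ T) (hV : 0 ≤ V) :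
    T * rate b V T = max (V ^ (1 / (b + 2)) * (T : ℝ) ^ ((b + 1) / (b + 2)))
      ((T : ℝ) ^ (b / (b + 1))) := by
  have hT0 : (0 : ℝ) < T := by exact_mod_cast hT
  unfold rate
  rw [mul_max_of_nonneg _ _ hT0.le]
  congr 1
  · rw [Real.div_rpow hV hT0.le, show (b + 1) / (b + 2) = 1 - 1 / (b + 2) by field_simp; ring,
      Real.rpow_sub hT0, Real.rpow_one]
    ring
  · rw [show b / (b + 1) = 1 - 1 / (b + 1) by field_simp; ring, Real.rpow_sub hT0, Real.rpow_one]
    ring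

theorem one_le_mul_rate (hb : 0 ≤ b) (hT : 1 ≤ T) (hV : 0 ≤ V) (hVT : V ≤ T) :
    1 ≤ T * rate b V T := by
  refine (one_le_mul_rate_rpow (V := V) hb hT).trans (mul_le_mul_of_nonneg_left ?_ T.cast_nonneg)
  have := Real.rpow_le_rpow_of_exponent_ge (rate_pos hT) (rate_le_one hb hT hV hVT)
    (by linarith : 1 ≤ b + 1)
  rwa [Real.rpow_one] at this

theorem budget_le_mul_rate (hb : 0 ≤ b) (hT : 1 ≤ T) (hV : 0 ≤ V) (hVT : V ≤ T) :
    V ≤ T * rate b V T := by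
  refine (budget_le_mul_rate_rpow hb hT hV).trans (mul_le_mul_of_nonneg_left ?_ T.cast_nonneg)
  have := Real.rpow_le_rpow_of_exponent_ge (rate_pos hT) (rate_le_one hb hT hV hVT)
    (by linarith : 1 ≤ b + 2)
  rwa [Real.rpow_one] at this

/-- The balancing step. With `g = rate b V T`, the first term of the maximum gives `V ≤ T g^(b+2)`
and the second gives `1 ≤ T g^(b+1)`, so both `V g^(-b-1)` and `g^(-b)` are at most `T g`. -/
theorem budget_div_add_one_mul_le (hb : 0 ≤ b) (hT : 1 ≤ T) (hV : 0 ≤ V) {c₁ : ℝ} (hc₁ : 0 < c₁) :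
    (V / (c₁ * rate b V T) + 1) * (c₁ * rate b V T) ^ (-b) ≤
      (c₁ ^ (-b - 1) + c₁ ^ (-b)) * (T * rate b V T) := by
  have h1 := budget_le_mul_rate_rpow hb hT hV
  have h2 := one_le_mul_rate_rpow (V := V) hb hT
  have hg := rate_pos (b := b) (V := V) hT
  set g := rate b V T
  have e1 : V / (c₁ * g) * (c₁ * g) ^ (-b) = c₁ ^ (-b - 1) * (V * g ^ (-b - 1)) := by
    rw [Real.mul_rpow hc₁.le hg.le, Real.rpow_sub hc₁, Real.rpow_sub hg, Real.rpow_one,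
      Real.rpow_one]
    field_simp
  have e2 : (c₁ * g) ^ (-b) = c₁ ^ (-b) * g ^ (-b) := Real.mul_rpow hc₁.le hg.le
  have h3 : V * g ^ (-b - 1) ≤ T * g := by
    refine (mul_le_mul_of_nonneg_right h1 (by positivity)).trans_eq ?_
    rw [mul_assoc, ← Real.rpow_add hg, show b + 2 + (-b - 1) = 1 by ring, Real.rpow_one]
  have h4 : g ^ (-b) ≤ T * g := by
    refine (le_mul_of_one_le_left (by positivity) h2).trans_eq ?_
    rw [mul_assoc, ← Real.rpow_add hg, show b + 1 + -b = 1 by ring, Real.rpow_one]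
  rw [add_mul, one_mul, e1, e2, add_mul]
  exact add_le_add (mul_le_mul_of_nonneg_left h3 (by positivity))
    (mul_le_mul_of_nonneg_left h4 (by positivity))

end Rate

theorem block_length_le {β cL δ L : ℝ} (hβ : 0 ≤ β) (hcL : 0 < cL) (hδ : 0 < δ) (hδ1 : δ ≤ 1)
    (hL : 0 ≤ L) :
    4 * L / (cL * (δ / 2) ^ β) + 1 ≤ (4 * 2 ^ β / cL + 1) * (1 + L) * δ ^ (-β) := by
  have hδβ : 1 ≤ δ ^ (-β) := Real.one_le_rpow_of_pos_of_le_one_of_nonpos hδ hδ1 (by linarith)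
  have e : 4 * L / (cL * (δ / 2) ^ β) = 4 * 2 ^ β / cL * L * δ ^ (-β) := by
    rw [Real.div_rpow hδ.le zero_le_two, Real.rpow_neg hδ.le]
    field_simp
  have h0 : 0 ≤ 4 * 2 ^ β / cL := by positivity
  rw [e]
  generalize 4 * 2 ^ β / cL = K at *
  have h1 : K * L + 1 ≤ (K + 1) * (1 + L) := by nlinarith
  have h2 := mul_le_mul_of_nonneg_right h1 (zero_le_one.trans hδβ)
  linarith

theorem one_add_mul_log_le {c L a x y : ℝ} (hc : 0 ≤ c) (hL : 0 ≤ L) (ha : 0 ≤ a)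
    (hx : x ≤ L + a) (hy : 1 ≤ y) :
    1 + c * (1 + x / Real.log 2) * y ≤
      (1 + c * (1 + (1 + a) / Real.log 2)) * (1 + L) * y := by
  have hlog2 := Real.log_pos one_lt_two
  have h1 : x / Real.log 2 ≤ (1 + a) / Real.log 2 * (1 + L) := by
    rw [← mul_div_right_comm]
    refine div_le_div_of_nonneg_right ?_ hlog2.le
    nlinarith
  have h2 : 1 + x / Real.log 2 ≤ (1 + (1 + a) / Real.log 2) * (1 + L) := by linarith
  have h3 := mul_le_mul_of_nonneg_left h2 hc
  have h4 : 1 + c * (1 + x / Real.log 2) ≤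
      (1 + c * (1 + (1 + a) / Real.log 2)) * (1 + L) := by linarith
  have h5 := mul_le_mul_of_nonneg_right h4 (zero_le_one.trans hy)
  linarith

/-- The contribution to the expected regret of the event that the confidence bounds fail, or that
good initial means are too rare. -/
theorem failure_cost_le {T V c₁ δ M p B : ℝ} (hT1 : 1 ≤ T) (hV : 0 ≤ V) (hVT : V ≤ T)
    (hc₁ : 0 < c₁) (hδ : 0 < δ) (hδT : 1 / δ ≤ T / c₁) (hM : M ≤ 2 * V / δ + 1)
    (hB : 4 * Real.log T ≤ p * B) :
    T * (1 + V) * (T ^ 2 * (2 * Real.exp (-6 * Real.log T)) + M * Real.exp (-(p * B))) ≤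
      6 + 4 / c₁ := by
  have hT0 : 0 < T := by linarith
  have e6 : Real.exp (-6 * Real.log T) = 1 / T ^ 6 := by
    rw [neg_mul, Real.exp_neg, show 6 * Real.log T = ((6 : ℕ) : ℝ) * Real.log T by norm_num,
      Real.exp_nat_mul, Real.exp_log hT0, one_div]
  have e4 : Real.exp (-(p * B)) ≤ 1 / T ^ 4 := by
    refine (Real.exp_le_exp.2 (neg_le_neg hB)).trans_eq ?_
    rw [Real.exp_neg, show 4 * Real.log T = ((4 : ℕ) : ℝ) * Real.log T by norm_num,
      Real.exp_nat_mul, Real.exp_log hT0, one_div]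
  have hM' : M ≤ (2 / c₁ + 1) * T ^ 2 := by
    have h1 : 2 * V / δ ≤ 2 / c₁ * T ^ 2 := by
      calc 2 * V / δ = 2 * V * (1 / δ) := by ring
        _ ≤ 2 * T * (T / c₁) := by gcongr
        _ = _ := by ring
    have h2 : 1 ≤ T ^ 2 := one_le_pow₀ hT1
    linarith
  -- Regret `O(T²)` times failure probability `O(T⁻²)` stays bounded: the noise fails with
  -- probability `O(T⁻⁴)`, and each of the `O(T²)` blocks with probability at most `T⁻⁴`.
  have hTV : T * (1 + V) ≤ 2 * T ^ 2 := by nlinarith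
  rw [e6]
  calc _ ≤ T * (1 + V) * (T ^ 2 * (2 * (1 / T ^ 6)) + (2 / c₁ + 1) * T ^ 2 * (1 / T ^ 4)) := by
        gcongr
    _ ≤ 2 * T ^ 2 * (T ^ 2 * (2 * (1 / T ^ 6)) + (2 / c₁ + 1) * T ^ 2 * (1 / T ^ 4)) := by
        gcongr
    _ = 4 * (1 / T ^ 2) + 2 * (2 / c₁ + 1) := by field_simp; ring
    _ ≤ 4 * 1 + 2 * (2 / c₁ + 1) := by
        gcongr
        exact (div_le_one (by positivity)).2 (one_le_pow₀ hT1)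
    _ = _ := by ring

/-- The regret with threshold `c₁ * rate b V T` is of the order of `T * rate b V T`. -/
theorem exists_integral_regret_le (β b c₁ cL cU : ℝ) (hb1 : 1 ≤ b) (hbβ : β ≤ b) (hβ : 0 < β)
    (hc₁ : 0 < c₁) (hc₁' : c₁ < 1) (hcL : 0 < cL) (hcU : 0 < cU) :
    ∃ C : ℝ, 0 < C ∧ ∀ (T : ℕ), 1 ≤ T → ∀ (V : ℝ), 0 ≤ V → V ≤ T →
      ∀ (A : Type*) (sel : ℕ → A), Function.Injective sel →
      ∀ (Ω : Type*) (mΩ : MeasurableSpace Ω) (P : Measure Ω) (_ : IsProbabilityMeasure P)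
        (ℱ : Filtration ℕ mΩ) (μ₁ : A → Ω → ℝ) (ρ η : ℕ → Ω → ℝ),
        IsSlowRotting P ℱ β cL cU T V μ₁ ρ η →
        ∫ ω, regret sel T (c₁ * rate b V T) (fun a => μ₁ a ω) (fun t => ρ t ω)
          (fun t => η t ω) ∂P ≤ C * (1 + Real.log (T : ℝ)) ^ 3 * (T * rate b V T) := by
  have hlog2 := Real.log_pos one_lt_two
  have hlogc : 0 ≤ Real.log (1 / c₁) :=
    Real.log_nonneg (by rw [le_div_iff₀ hc₁]; linarith)
  set K₁ : ℝ := 4 * 2 ^ β / cL + 1 with hK₁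
  set K₂ : ℝ := 1 + cU * (1 + (1 + Real.log (1 / c₁)) / Real.log 2) with hK₂
  set K₄ : ℝ := c₁ ^ (-b - 1) + c₁ ^ (-b)
  have hK₁0 : 0 < K₁ := by positivity
  have hK₂0 : 0 < K₂ := by positivity
  have hK₄0 : 0 < K₄ := by positivity
  refine ⟨3 + 2000 * K₁ * K₂ * K₄ + (6 + 4 / c₁), by positivity, ?_⟩
  intro T hT V hV hVT A sel hsel Ω mΩ P _ ℱ μ₁ ρ η h
  have hT1 : (1 : ℝ) ≤ T := by exact_mod_cast hT
  have hT0 : (0 : ℝ) < T := by linarith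
  have hb0 : 0 ≤ b := by linarith
  have hL := Real.log_natCast_nonneg T
  have hg := rate_pos (b := b) (V := V) hT
  have hg1 := rate_le_one hb0 hT hV hVT
  have hf1 := one_le_mul_rate hb0 hT hV hVT
  have hfV := budget_le_mul_rate hb0 hT hV hVT
  have hmain := budget_div_add_one_mul_le hb0 hT hV hc₁
  set g := rate b V T
  set δ := c₁ * g with hδdef
  have hδ : 0 < δ := by positivity
  have hδg : δ ≤ g := mul_le_of_le_one_left hg.le hc₁'.le
  have hδ1 : δ ≤ 1 := hδg.trans hg1
  have hδT : 1 / δ ≤ T / c₁ := by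
    rw [div_le_div_iff₀ hδ hc₁, hδdef]
    linarith [mul_le_mul_of_nonneg_left hf1 hc₁.le]
  set L := Real.log (T : ℝ) with hLdef
  set p := cL * (δ / 2) ^ β with hp
  have hp0 : 0 < p := by positivity
  -- `M` is the least natural number with `M δ / 2 > V`; `B` makes the failure probability `exp (-p
  -- B)` of a block at most `T⁻⁴`.
  set M := ⌊2 * V / δ⌋₊ + 1 with hMdef
  set B := ⌈4 * L / p⌉₊ with hBdef
  have hM1 : 2 * V / δ < M := by
    rw [hMdef]; push_cast; exact Nat.lt_floor_add_one _
  have hM2 : (M : ℝ) ≤ 2 * V / δ + 1 := by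
    rw [hMdef]; push_cast
    exact add_le_add (Nat.floor_le (by positivity)) le_rfl
  have hB1 : 4 * L ≤ p * B := by
    have := Nat.le_ceil (4 * L / p)
    rw [div_le_iff₀ hp0] at this
    linarith
  have hB2 : (B : ℝ) ≤ 4 * L / p + 1 := (Nat.ceil_lt_add_one (by positivity)).le
  have hM : V < M * (δ / 2) := by
    rw [div_lt_iff₀ hδ] at hM1
    linarith
  refine (h.integral_regret_le hsel hcU hV hδ hδ1 hb1 hbβ (M := M) (B := B) hM).trans ?_
  have hBK : (B : ℝ) ≤ K₁ * (1 + L) * δ ^ (-β) := hB2.trans (block_length_le hβ.le hcL hδ hδ1 hL)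
  have hEK : 1 + cU * (1 + Real.log (1 / δ) / Real.log 2) * δ ^ (β - b) ≤
      K₂ * (1 + L) * δ ^ (β - b) := by
    have h1 : Real.log (1 / δ) ≤ L + Real.log (1 / c₁) := by
      rw [hLdef, ← Real.log_mul hT0.ne' (by positivity)]
      exact Real.log_le_log (by positivity) (by rwa [mul_one_div])
    exact one_add_mul_log_le hcU.le hL hlogc h1
      (Real.one_le_rpow_of_pos_of_le_one_of_nonpos hδ hδ1 (by linarith))
  have hM3 : (M : ℝ) ≤ 2 * (V / δ + 1) := by
    rw [mul_div_assoc] at hM2; linarith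
  have hlead : (M : ℝ) * B * (1 + cU * (1 + Real.log (1 / δ) / Real.log 2) * δ ^ (β - b)) ≤
      2 * K₁ * K₂ * (1 + L) ^ 2 * (K₄ * (T * g)) := by
    have hlogδ : 0 ≤ Real.log (1 / δ) :=
      Real.log_nonneg (by rw [le_div_iff₀ hδ]; linarith)
    calc _ ≤ (2 * (V / δ + 1)) * (K₁ * (1 + L) * δ ^ (-β)) * (K₂ * (1 + L) * δ ^ (β - b)) := by
          gcongr
      _ = 2 * K₁ * K₂ * (1 + L) ^ 2 * ((V / δ + 1) * (δ ^ (-β) * δ ^ (β - b))) := by ring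
      _ = 2 * K₁ * K₂ * (1 + L) ^ 2 * ((V / δ + 1) * δ ^ (-b)) := by
          rw [← Real.rpow_add hδ, show -β + (β - b) = -b by ring]
      _ ≤ _ := mul_le_mul_of_nonneg_left hmain (by positivity)
  have hfail : T * (1 + V) * ((T : ℝ) ^ 2 * (2 * Real.exp (-6 * L)) + M * Real.exp (-(p * B))) ≤
      6 + 4 / c₁ :=
    failure_cost_le hT1 hV hVT hc₁ hδ hδT hM2 hB1
  have hlead' := mul_le_mul_of_nonneg_left hlead (by positivity : 0 ≤ 1000 * (1 + L))
  have hX : T * g ≤ (1 + L) ^ 3 * (T * g) :=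
    le_mul_of_one_le_left (by positivity) (one_le_pow₀ (by linarith))
  have hδTg : 2 * δ * T ≤ 2 * (T * g) := by
    linarith [mul_le_mul_of_nonneg_right hδg hT0.le]
  have hfail' : 6 + 4 / c₁ ≤ (6 + 4 / c₁) * ((1 + L) ^ 3 * (T * g)) :=
    le_mul_of_one_le_right (by positivity) (hf1.trans hX)
  calc _ ≤ 2 * (T * g) + T * g + 1000 * (1 + L) *
        (2 * K₁ * K₂ * (1 + L) ^ 2 * (K₄ * (T * g))) + (6 + 4 / c₁) :=
        add_le_add (add_le_add (add_le_add hδTg hfV) hlead') hfail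
    _ ≤ 3 * ((1 + L) ^ 3 * (T * g)) + 2000 * K₁ * K₂ * K₄ * ((1 + L) ^ 3 * (T * g)) +
        (6 + 4 / c₁) * ((1 + L) ^ 3 * (T * g)) := by
        refine add_le_add (add_le_add (by linarith) (le_of_eq (by ring))) hfail'
    _ = _ := by ring

theorem deltaV_of_one_le {c₁ β V : ℝ} {T : ℕ} (hβ : 1 ≤ β) :
    deltaV c₁ β V T = c₁ * rate β V T := by
  rw [deltaV, if_pos hβ, rate]

theorem deltaV_of_lt_one {c₁ β V : ℝ} {T : ℕ} (hβ : β < 1) :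
    deltaV c₁ β V T = c₁ * rate 1 V T := by
  rw [deltaV, if_neg (not_le.2 hβ), rate, Real.sqrt_eq_rpow]
  norm_num

end RottingBandit

theorem theorem1 (β c₁ cL cU : ℝ) (hβ : 0 < β) (hc₁ : 0 < c₁) (hc₁' : c₁ < 1)
    (hcL : 0 < cL) (hcU : 0 < cU) :
    ∃ C : ℝ, 0 < C ∧ ∃ k : ℕ,
      ∀ (T : ℕ), 1 ≤ T → ∀ (V : ℝ), 0 ≤ V → V ≤ T →
      ∀ (A : Type*) (sel : ℕ → A), Function.Injective sel →
      ∀ (Ω : Type*) (mΩ : MeasurableSpace Ω) (P : Measure Ω) (_ : IsProbabilityMeasure P)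
        (ℱ : Filtration ℕ mΩ) (μ₁ : A → Ω → ℝ) (ρ η : ℕ → Ω → ℝ),
        RottingBandit.IsSlowRotting P ℱ β cL cU T V μ₁ ρ η →
        Integrable (RottingBandit.regretV sel T c₁ β V μ₁ ρ η) P ∧
        (1 ≤ β → ∫ ω, RottingBandit.regretV sel T c₁ β V μ₁ ρ η ω ∂P ≤
          C * (1 + Real.log (T : ℝ)) ^ k *
          max (V ^ (1 / (β + 2)) * (T : ℝ) ^ ((β + 1) / (β + 2))) ((T : ℝ) ^ (β / (β + 1)))) ∧
        (β < 1 → ∫ ω, RottingBandit.regretV sel T c₁ β V μ₁ ρ η ω ∂P ≤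
          C * (1 + Real.log (T : ℝ)) ^ k *
          max (V ^ (1 / 3 : ℝ) * (T : ℝ) ^ (2 / 3 : ℝ)) (√(T : ℝ))) := by
  -- Both regimes are the case `b = max β 1`: for `β < 1` the mean of `1 / max Δ δ` is already
  -- bounded up to `δ^(β-1)`, which gives the exponents of `b = 1`.
  obtain ⟨C, hC, h⟩ := RottingBandit.exists_integral_regret_le β (max β 1) c₁ cL cU
    (le_max_right _ _) (le_max_left _ _) hβ hc₁ hc₁' hcL hcU
  refine ⟨C, hC, 3, fun T hT V hV hVT A sel hsel Ω mΩ P hP ℱ μ₁ ρ η hR =>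
    ⟨hR.integrable_regret hsel, fun hβ1 => ?_, fun hβ1 => ?_⟩⟩
  · have h1 := h T hT V hV hVT A sel hsel Ω mΩ P hP ℱ μ₁ ρ η hR
    rw [max_eq_left hβ1, ← RottingBandit.deltaV_of_one_le hβ1,
      RottingBandit.mul_rate hβ.le hT hV] at h1
    exact h1
  · have h1 := h T hT V hV hVT A sel hsel Ω mΩ P hP ℱ μ₁ ρ η hR
    rw [max_eq_right hβ1.le, ← RottingBandit.deltaV_of_lt_one hβ1,
      RottingBandit.mul_rate zero_le_one hT hV] at h1
    rw [Real.sqrt_eq_rpow]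
    norm_num at h1 ⊢
    exact h1
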